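/- Throughout, $\log$ is the logarithm to base $2$, $\log 0=-\infty$, and $\inf\emptyset=+\infty$. Let $A$ be a finite set, $P$ a probability distribution on $A$ with $P(a)>0$ for all $a\in A$, and $M:A\to(0,\infty)$ a mass function. Let $\rho:A\times A\to[0,\infty)$ be such that for each $a\in A$ there is a $b\in A$ with $\rho(a,b)=0$. For $x,y\in A^n$ put $\rho_n(x,y)=\frac1n\sum_{i=1}^n\rho(x_i,y_i)$. For $C_n\subset A^n$ put $$[C_n]_D=\{x\in A^n:\ \rho_n(x,y)\le D\text{ for some }y\in C_n\},\qquad M^n(C_n)=\sum_{y\in C_n}\prod_{i=1}^nM(y_i),\qquad P^n(C_n)=\sum_{y\in C_n}\prod_{i=1}^nP(y_i).$$ Let $D_{\max}=\max_{x,y\in A}\rho(x,y)$ and $R_{\max}=\log M(A)=\log\sum_{a\in A}M(a)$. For probability distributions $\mu,\nu$ on a common finite set $S$ let $H(\mu\|\nu)=\sum_{s\in S}\mu(s)\log\frac{\mu(s)}{\nu(s)}$ be the relative entropy (with $0\log\frac{0}{\cdot}=0$, and $H(\mu\|\nu)=+\infty$ if $\mu(s)>0=\nu(s)$ for some $s$).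 For a probability distribution $Q$ on $A$ and $D\ge0$ let $$R(D;Q,M)=\inf\big\{H(P_{X,Y}\|Q\times P_Y)+E[\log M(Y)]\ :\ X\sim Q,\ E\rho(X,Y)\le D\big\},$$ where the infimum is over all pairs $(X,Y)$ of $A$-valued random variables with $X\sim Q$ and $E\rho(X,Y)\le D$, and $P_{X,Y}$ and $P_Y$ are the laws of $(X,Y)$ and of $Y$. For $R\in\mathbb R$ let $\mathcal C(R)$ be the collection of all sequences of sets $C_n\subset A^n$, $n\ge1$, with $\limsup_{n}\frac1n\log M^n(C_n)\le R$, and define the best achievable error exponent $$E(R,D)=\sup_{\{C_n\}\in\mathcal C(R)}\ \liminf_{n\to\infty}\,-\frac1n\log\big[1-P^n([C_n]_D)\big]\in[0,+\infty].$$ **Theorem.** For all $D\in[0,D_{\max})$ and all $R$ with $R(D;P,M)<R<R_{\max}$, $$E(R,D)=E^*(R,D):=\inf\{H(Q\|P)\ :\ Q\text{ a probability distribution on }A\text{ with }R(D;Q,M)>R\},$$ where both sides may equal $+\infty$. -/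

import Mathlib

namespace SphereCovering

open Filter

/-- Base-2 logarithm of a nonnegative real number with values in `[-∞, ∞]`; `log 0 = -∞`. -/
noncomputable def log2 (x : ℝ) : EReal :=
  if x ≤ 0 then ⊥ else ((Real.logb 2 x : ℝ) : EReal)

/-- Relative entropy `H(μ‖ν) = ∑ μ(s) log (μ(s) / ν(s))` in bits of two mass functions on a finite
set, with `0 log (0 / ν) = 0`, and `+∞` if `μ` charges a point that `ν` does not charge. -/
noncomputable def relEntropy {S : Type*} [Fintype S] (μ ν : S → ℝ) : EReal :=
  open Classical in
  if ∀ s, ν s = 0 → μ s = 0 then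
    ((∑ s, μ s * Real.logb 2 (μ s / ν s) : ℝ) : EReal)
  else ⊤

section

variable {A : Type*} [Fintype A]

/-- `D_max`, the largest value of the distortion `ρ`. -/
noncomputable def Dmax (ρ : A → A → ℝ) : ℝ :=
  ⨆ p : A × A, ρ p.1 p.2

/-- `R_max = log M(A)`. -/
noncomputable def Rmax (M : A → ℝ) : ℝ :=
  Real.logb 2 (∑ a, M a)

/-- The single-letter distortion `ρ_n(x, y) = (1/n) ∑ ρ(x_i, y_i)`. -/
noncomputable def distortion (ρ : A → A → ℝ) {n : ℕ} (x y : Fin n → A) : ℝ :=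
  (1 / (n : ℝ)) * ∑ i, ρ (x i) (y i)

/-- The `D`-blowup `[C]_D` of `C`: the union of the closed balls of radius `D` centered
at the points `y ∈ C`. -/
noncomputable def blowup (ρ : A → A → ℝ) (D : ℝ) {n : ℕ} (C : Finset (Fin n → A)) :
    Finset (Fin n → A) :=
  open Classical in
  Finset.univ.filter fun x => ∃ y ∈ C, distortion ρ x y ≤ D

/-- The product mass `m^n(C) = ∑_{y ∈ C} ∏_i m(y_i)`; used for both `P^n` and `M^n`. -/
noncomputable def prodMass (m : A → ℝ) {n : ℕ} (C : Finset (Fin n → A)) : ℝ :=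
  ∑ y ∈ C, ∏ i, m (y i)

/-- The joint laws `μ` of pairs `(X, Y)` with `X ∼ P` and `E ρ(X, Y) ≤ D`. -/
def couplings (ρ : A → A → ℝ) (D : ℝ) (P : A → ℝ) : Set (A × A → ℝ) :=
  {μ | μ ∈ stdSimplex ℝ (A × A) ∧ (∀ x, ∑ y, μ (x, y) = P x) ∧
    ∑ p, μ p * ρ p.1 p.2 ≤ D}

/-- The law `P_Y` of the second coordinate. -/
def sndMarginal (μ : A × A → ℝ) (y : A) : ℝ :=
  ∑ x, μ (x, y)

/-- The rate function `R(D; P, M)`, the infimum of `H(P_{XY} ‖ P × P_Y) + E[log M(Y)]`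
over all pairs with `X ∼ P` and `E ρ(X, Y) ≤ D`. -/
noncomputable def rate (ρ : A → A → ℝ) (D : ℝ) (P M : A → ℝ) : EReal :=
  ⨅ μ ∈ couplings ρ D P,
    relEntropy μ (fun p => P p.1 * sndMarginal μ p.2) +
      ((∑ y, sndMarginal μ y * Real.logb 2 (M y) : ℝ) : EReal)

/-- `𝒞(R)`: sequences of sets `C_n ⊆ A^n` with `limsup (1/n) log M^n(C_n) ≤ R`. -/
def massBounded (M : A → ℝ) (R : ℝ) : Set ((n : ℕ) → Finset (Fin n → A)) :=
  {C | limsup (fun n : ℕ => ((1 / (n : ℝ) : ℝ) : EReal) * log2 (prodMass M (C n))) atTop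
    ≤ (R : EReal)}

/-- The best achievable error exponent `E(R, D)`. -/
noncomputable def bestExponent (ρ : A → A → ℝ) (P M : A → ℝ) (R D : ℝ) : EReal :=
  ⨆ C ∈ massBounded M R,
    liminf (fun n : ℕ =>
      -(((1 / (n : ℝ) : ℝ) : EReal) * log2 (1 - prodMass P (blowup ρ D (C n))))) atTop

/-- `E*(R, D)`, the infimum of `H(Q‖P)` over all probability distributions `Q` on `A` with
`R(D; Q, M) > R` (and `+∞` if there is none). -/
noncomputable def Estar (ρ : A → A → ℝ) (P M : A → ℝ) (R D : ℝ) : EReal :=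
  ⨅ Q ∈ {Q : A → ℝ | Q ∈ stdSimplex ℝ A ∧ (R : EReal) < rate ρ D Q M}, relEntropy Q P

end

end SphereCovering

/-!
The proof works with types (empirical distributions of words) and with natural logarithms. On
couplings the functional minimized in `rate` equals `rateInfo / log 2`, where `rateInfo` is a
combination of entropies and is therefore continuous (`rate_summand_eq`, `continuous_rateInfo`).

*Achievability* (`Estar_le_bestExponent`). A greedy argument covers a type class by words of a fixed
joint type with it, at a mass of `exp (n * rateInfo)` up to a polynomial factor
(`exists_typeClass_cover`). An arbitrary coupling of the type of `x` is rounded to a joint type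
without increasing the distortion, since each letter has a letter at distortion zero
(`exists_word_near_coupling`). As `rateInfo` is uniformly continuous on the simplex and the number
of types is polynomial in `n`, all words whose type `Q` has `R(D; Q, M) ≤ R` are covered at exponent
`R`. What remains uncovered consists of types `Q` with `R(D; Q, M) > R`, so that its `P^n`-mass is at
most `2 ^ (-n E*)` up to a polynomial factor (`prodMass_le_of_le_klNat`); if there are no such types,
nothing is left uncovered and both sides are `+∞`.

*Converse* (`bestExponent_le_Estar`). Let `R(D; Q, M) > R`. If `C_n` covered `Q^n`-mass close to one,
then averaging the joint law of `X^n ∼ Q^n` and its quantization over the coordinates would give a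
coupling at a distortion slightly above `D` whose cost is at most `(1/n) log M^n(C_n)`
(`exists_coupling_le_log_prodMass`), against the compactness bound `exists_gap_of_lt_rate`. Hence
the uncovered set has `Q^n`-mass bounded below, and a change of measure gives it `P^n`-mass at least
`2 ^ (-n (H(Q‖P) + δ))` (`eventually_exp_le_prodMass`).
-/

namespace SphereCovering

open Filter Real

/-! ### Types and type classes -/

section Types

variable {S : Type*} [DecidableEq S] {n : ℕ}

/-- The number of occurrences of the letter `s` in the word `x`. -/
def typeCount (x : Fin n → S) (s : S) : ℕ :=
  (Finset.univ.filter fun i => x i = s).card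

theorem typeCount_comp_perm (x : Fin n → S) (σ : Equiv.Perm (Fin n)) :
    typeCount (x ∘ σ) = typeCount x := by
  funext s
  exact Finset.card_equiv σ (by simp)

theorem exists_perm_of_typeCount_eq {x y : Fin n → S} (h : typeCount x = typeCount y) :
    ∃ σ : Equiv.Perm (Fin n), x ∘ σ = y := by
  have e : ∀ s, Nonempty ({i // y i = s} ≃ {i // x i = s}) := fun s => by
    refine ⟨Fintype.equivOfCardEq ?_⟩
    rw [Fintype.card_subtype, Fintype.card_subtype]
    exact (congrFun h s).symm
  refine ⟨Equiv.ofFiberEquiv fun s => (e s).some, ?_⟩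
  funext i
  exact Equiv.ofFiberEquiv_map _ i

theorem typeCount_le (x : Fin n → S) (s : S) : typeCount x s ≤ n := by
  simpa [typeCount] using Finset.card_filter_le (Finset.univ : Finset (Fin n)) fun i => x i = s

variable [Fintype S]

theorem sum_apply_eq_sum_typeCount (x : Fin n → S) (f : S → ℝ) :
    ∑ i, f (x i) = ∑ s, (typeCount x s : ℝ) * f s := by
  rw [← Finset.sum_fiberwise (Finset.univ : Finset (Fin n)) x]
  refine Finset.sum_congr rfl fun s _ => ?_
  rw [Finset.sum_congr rfl (g := fun _ => f s)]
  · simp [typeCount]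
  · intro i hi
    rw [(Finset.mem_filter.1 hi).2]

theorem sum_typeCount (x : Fin n → S) : ∑ s, typeCount x s = n := by
  have := sum_apply_eq_sum_typeCount x fun _ => 1
  simp only [Finset.sum_const, Finset.card_univ, Fintype.card_fin, nsmul_eq_mul, mul_one] at this
  exact_mod_cast this.symm

theorem exists_typeCount_eq (j : S → ℕ) (hj : ∑ s, j s = n) :
    ∃ z : Fin n → S, typeCount z = j := by
  have e : Nonempty (Fin n ≃ Σ s, Fin (j s)) :=
    ⟨Fintype.equivOfCardEq (by simp [hj])⟩
  obtain ⟨e⟩ := e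
  refine ⟨fun i => (e i).1, funext fun s => ?_⟩
  have h1 : typeCount (fun i => (e i).1) s =
      ((Finset.univ : Finset (Σ s, Fin (j s))).filter fun p => p.1 = s).card :=
    Finset.card_equiv e (by simp)
  have h2 : (Finset.univ : Finset (Fin (j s))).card =
      ((Finset.univ : Finset (Σ s, Fin (j s))).filter fun p => p.1 = s).card := by
    refine Finset.card_bij (fun i _ => ⟨s, i⟩) (by simp) (by simp) ?_
    rintro ⟨t, i⟩ h
    obtain rfl : t = s := by simpa using h
    exact ⟨i, by simp, rfl⟩
  rw [h1, ← h2, Finset.card_univ, Fintype.card_fin]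

/-- The type class of a word `x`: all words with the same letter counts. -/
def typeClass (x : Fin n → S) : Finset (Fin n → S) :=
  Finset.univ.filter fun y => typeCount y = typeCount x

theorem mem_typeClass {x y : Fin n → S} : y ∈ typeClass x ↔ typeCount y = typeCount x := by
  simp [typeClass]

theorem self_mem_typeClass (x : Fin n → S) : x ∈ typeClass x := mem_typeClass.2 rfl

theorem card_typeClass_pos (x : Fin n → S) : 0 < (typeClass x).card :=
  Finset.card_pos.2 ⟨x, self_mem_typeClass x⟩

/-- The type class is an orbit of the symmetric group, so its size is a multinomial coefficient. -/
theorem card_typeClass_mul_prod_factorial (x : Fin n → S) :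
    (typeClass x).card * ∏ s, (typeCount x s).factorial = n.factorial := by
  have h := Finset.card_eq_sum_card_fiberwise (s := (Finset.univ : Finset (Equiv.Perm (Fin n))))
    (t := typeClass x) (f := fun σ : Equiv.Perm (Fin n) => x ∘ σ)
    (fun σ _ => mem_typeClass.2 (typeCount_comp_perm x σ))
  rw [Finset.card_univ, Fintype.card_perm, Fintype.card_fin] at h
  rw [h, ← smul_eq_mul]
  refine (Finset.sum_const _).symm.trans (Finset.sum_congr rfl fun y hy => ?_)
  obtain ⟨τ, rfl⟩ := exists_perm_of_typeCount_eq (mem_typeClass.1 hy).symm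
  have h2 := DomMulAct.stabilizer_card (f := x)
  simp only [Fintype.card_subtype] at h2
  rw [show (∏ s, (typeCount x s).factorial) = _ from h2.symm]
  -- `σ ↦ σ * τ` maps the stabilizer of `x` onto the permutations carrying `x` to `x ∘ τ`
  refine Finset.card_equiv (Equiv.mulRight τ) fun σ => ?_
  simp only [Finset.mem_filter, Finset.mem_univ, true_and, Equiv.coe_mulRight, Equiv.Perm.coe_mul,
    ← Function.comp_assoc]
  exact (τ.surjective.injective_comp_right.eq_iff).symm

end Types

/-! ### Factorial bounds and the size of a type class -/

theorem mul_log_sub_le_log_factorial (k : ℕ) : (k : ℝ) * log k - k ≤ log k.factorial := by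
  rcases Nat.eq_zero_or_pos k with rfl | hk
  · simp
  have hk' : (0 : ℝ) < k := by exact_mod_cast hk
  have hf : (0 : ℝ) < k.factorial := by exact_mod_cast k.factorial_pos
  have h := log_le_log (by positivity) (Real.pow_div_factorial_le_exp (x := k) hk'.le k)
  rw [log_exp, log_div (by positivity) hf.ne', log_pow] at h
  linarith

theorem log_factorial_le {k : ℕ} (hk : 0 < k) :
    log k.factorial ≤ k * log k - k + (log k + 1) := by
  obtain ⟨m, rfl⟩ := Nat.exists_eq_succ_of_ne_zero hk.ne'
  have hk' : (0 : ℝ) < (m + 1 : ℕ) := by exact_mod_cast hk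
  have h := Stirling.log_stirlingSeq'_antitone (Nat.zero_le m)
  simp only [Function.comp, Nat.succ_eq_add_one] at h
  rw [Stirling.log_stirlingSeq_formula, Stirling.log_stirlingSeq_formula] at h
  simp only [zero_add, Nat.factorial_one, Nat.cast_one, log_one, mul_one, one_mul] at h
  rw [log_mul two_ne_zero hk'.ne', log_div hk'.ne' (exp_pos 1).ne', log_exp,
    log_div one_ne_zero (exp_pos 1).ne', log_exp, log_one] at h
  have h0 : 0 ≤ log ((m + 1 : ℕ) : ℝ) := log_natCast_nonneg _
  simp only [Nat.succ_eq_add_one]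
  linarith

/-- Shannon entropy, in nats, of a mass function. -/
noncomputable def entropy {S : Type*} [Fintype S] (μ : S → ℝ) : ℝ := ∑ s, negMulLog (μ s)

section Empirical

variable {S : Type*} [DecidableEq S] [Fintype S] {n : ℕ}

/-- The empirical distribution (type) of a word. -/
noncomputable def empirical (x : Fin n → S) (s : S) : ℝ := typeCount x s / n

theorem empirical_mem_stdSimplex (hn : 0 < n) (x : Fin n → S) :
    empirical x ∈ stdSimplex ℝ S := by
  have hn' : (n : ℝ) ≠ 0 := by exact_mod_cast hn.ne'
  refine ⟨fun s => by unfold empirical; positivity, ?_⟩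
  unfold empirical
  rw [← Finset.sum_div, ← Nat.cast_sum, sum_typeCount, div_self hn']

theorem mul_entropy_empirical (hn : 0 < n) (x : Fin n → S) :
    n * entropy (empirical x) = n * log n - ∑ s, (typeCount x s : ℝ) * log (typeCount x s) := by
  have hn' : (n : ℝ) ≠ 0 := by exact_mod_cast hn.ne'
  have h1 : (n : ℝ) * log n = ∑ s, (typeCount x s : ℝ) * log n := by
    rw [← Finset.sum_mul, ← Nat.cast_sum, sum_typeCount]
  rw [h1, ← Finset.sum_sub_distrib, entropy, Finset.mul_sum]
  refine Finset.sum_congr rfl fun s _ => ?_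
  unfold empirical negMulLog
  rcases Nat.eq_zero_or_pos (typeCount x s) with h | h
  · simp [h]
  · have h' : (typeCount x s : ℝ) ≠ 0 := by exact_mod_cast h.ne'
    rw [log_div h' hn']
    field_simp
    ring

theorem log_card_typeClass (x : Fin n → S) :
    log (typeClass x).card = log n.factorial - ∑ s, log (typeCount x s).factorial := by
  have h : ((typeClass x).card : ℝ) * ∏ s, ((typeCount x s).factorial : ℝ) = n.factorial := by
    exact_mod_cast card_typeClass_mul_prod_factorial x
  have h0 : ((typeClass x).card : ℝ) ≠ 0 := by exact_mod_cast (card_typeClass_pos x).ne'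
  have h1 : ∀ s ∈ Finset.univ, ((typeCount x s).factorial : ℝ) ≠ 0 := fun s _ => by
    exact_mod_cast (Nat.factorial_pos _).ne'
  rw [← h, log_mul h0 (Finset.prod_ne_zero_iff.2 h1), log_prod h1]
  ring

theorem sum_typeCount_cast (x : Fin n → S) : ∑ s, (typeCount x s : ℝ) = n := by
  exact_mod_cast sum_typeCount x

theorem log_card_typeClass_le (hn : 0 < n) (x : Fin n → S) :
    log (typeClass x).card ≤ n * entropy (empirical x) + (log n + 1) := by
  rw [log_card_typeClass, mul_entropy_empirical hn]
  have h1 := log_factorial_le hn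
  have h2 : ∑ s, ((typeCount x s : ℝ) * log (typeCount x s) - typeCount x s) ≤
      ∑ s, log (typeCount x s).factorial :=
    Finset.sum_le_sum fun s _ => mul_log_sub_le_log_factorial _
  rw [Finset.sum_sub_distrib, sum_typeCount_cast] at h2
  linarith

theorem le_log_card_typeClass (hn : 0 < n) (x : Fin n → S) :
    n * entropy (empirical x) - Fintype.card S * (log n + 1) ≤ log (typeClass x).card := by
  rw [log_card_typeClass, mul_entropy_empirical hn]
  have h1 := mul_log_sub_le_log_factorial n
  have h2 : ∑ s, log (typeCount x s).factorial ≤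
      ∑ s, ((typeCount x s : ℝ) * log (typeCount x s) - typeCount x s + (log n + 1)) := by
    refine Finset.sum_le_sum fun s _ => ?_
    rcases Nat.eq_zero_or_pos (typeCount x s) with h | h
    · have : 0 ≤ log (n : ℝ) := log_natCast_nonneg n
      simp [h]
      linarith
    · have h3 := log_factorial_le h
      have h4 : log (typeCount x s : ℝ) ≤ log n :=
        log_le_log (by exact_mod_cast h) (by exact_mod_cast typeCount_le x s)
      linarith
  rw [Finset.sum_add_distrib, Finset.sum_sub_distrib, sum_typeCount_cast, Finset.sum_const,
    Finset.card_univ, nsmul_eq_mul] at h2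
  linarith

theorem card_image_typeCount_le (U : Finset (Fin n → S)) :
    (U.image typeCount).card ≤ (n + 1) ^ Fintype.card S := by
  refine (Finset.card_le_card (t := Fintype.piFinset fun _ : S => Finset.range (n + 1)) ?_).trans
    (by simp)
  intro k hk
  obtain ⟨x, -, rfl⟩ := Finset.mem_image.1 hk
  simpa [Fintype.mem_piFinset, Nat.lt_succ_iff] using typeCount_le x

end Empirical

/-! ### Greedy covering -/

section Cover

/-- Greedy covering: if every `x ∈ S` is related to at least `d` points of `T`, then about
`(|T| / d) log |S|` points of `T` suffice to meet every `x ∈ S`. -/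
theorem exists_small_cover {α β : Type*} (S : Finset α) (T : Finset β) (r : α → β → Prop) (d : ℕ)
    (hd : 0 < d)
    (h : ∀ x ∈ S, ∃ T' ⊆ T, (∀ y ∈ T', r x y) ∧ d ≤ T'.card) :
    ∃ C ⊆ T, (∀ x ∈ S, ∃ y ∈ C, r x y) ∧
      (C.card : ℝ) ≤ (T.card : ℝ) / d * log S.card + 1 := by
  classical
  rcases S.eq_empty_or_nonempty with rfl | hS
  · exact ⟨∅, by simp, by simp, by simp⟩
  have hT : d ≤ T.card := by
    obtain ⟨x, hx⟩ := hS
    obtain ⟨T', hT', -, h'⟩ := h x hx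
    exact h'.trans (Finset.card_le_card hT')
  have hdR : (0 : ℝ) < d := by exact_mod_cast hd
  have hTR : (d : ℝ) ≤ T.card := by exact_mod_cast hT
  have hT0 : (0 : ℝ) < T.card := hdR.trans_le hTR
  set t : ℝ := d / T.card with ht
  have ht0 : 0 < t := by positivity
  have ht1 : t ≤ 1 := (div_le_one hT0).2 hTR
  -- one greedy step shrinks the uncovered part by the factor `1 - t`
  have step : ∀ m : ℕ, ∃ C ⊆ T, C.card ≤ m ∧
      ((S.filter fun x => ∀ y ∈ C, ¬ r x y).card : ℝ) ≤ S.card * (1 - t) ^ m := by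
    intro m
    induction m with
    | zero => exact ⟨∅, by simp, by simp, by simp⟩
    | succ m ih =>
      obtain ⟨C, hCT, hCm, hC⟩ := ih
      set U := S.filter fun x => ∀ y ∈ C, ¬ r x y with hU
      have hdc : U.card * d ≤ ∑ y ∈ T, (U.filter fun x => r x y).card := by
        have : ∑ y ∈ T, (U.filter fun x => r x y).card =
            ∑ x ∈ U, (T.filter fun y => r x y).card :=
          (Finset.sum_card_bipartiteAbove_eq_sum_card_bipartiteBelow (s := U) (t := T) r).symm
        rw [this, ← smul_eq_mul]
        refine Finset.card_nsmul_le_sum _ _ _ fun x hx => ?_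
        obtain ⟨T', hT', h1, h2⟩ := h x (Finset.mem_filter.1 hx).1
        exact h2.trans (Finset.card_le_card fun y hy => Finset.mem_filter.2 ⟨hT' hy, h1 y hy⟩)
      obtain ⟨y, hyT, hy⟩ : ∃ y ∈ T, (U.card : ℝ) * t ≤ (U.filter fun x => r x y).card := by
        by_contra! hcon
        have hTne : T.Nonempty := Finset.card_pos.1 (hd.trans_le hT)
        have h1 := Finset.sum_lt_sum_of_nonempty hTne hcon
        have h2 : (U.card : ℝ) * d ≤ ∑ y ∈ T, ((U.filter fun x => r x y).card : ℝ) := by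
          exact_mod_cast hdc
        rw [Finset.sum_const, nsmul_eq_mul] at h1
        have h3 : (T.card : ℝ) * (U.card * t) = U.card * d := by
          rw [ht]; field_simp
        linarith
      refine ⟨insert y C, Finset.insert_subset hyT hCT,
        (Finset.card_insert_le _ _).trans (by omega), ?_⟩
      have hsplit := Finset.card_filter_add_card_filter_not (s := U) (fun x => r x y)
      have hsub : (S.filter fun x => ∀ z ∈ insert y C, ¬ r x z) ⊆ U.filter fun x => ¬ r x y := by
        intro x hx
        simp only [Finset.mem_filter, Finset.mem_insert, forall_eq_or_imp, hU] at hx ⊢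
        tauto
      have hle : ((S.filter fun x => ∀ z ∈ insert y C, ¬ r x z).card : ℝ) ≤
          (U.filter fun x => ¬ r x y).card := by
        exact_mod_cast Finset.card_le_card hsub
      have hsplit' : ((U.filter fun x => r x y).card : ℝ) + (U.filter fun x => ¬ r x y).card =
          U.card := by exact_mod_cast hsplit
      calc _ ≤ (U.card : ℝ) * (1 - t) := by linarith
        _ ≤ S.card * (1 - t) ^ m * (1 - t) := by gcongr
        _ = _ := by ring
  have hSR : (0 : ℝ) < S.card := by exact_mod_cast hS.card_pos
  have hlog : 0 ≤ log (S.card : ℝ) := log_natCast_nonneg _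
  set q : ℝ := (T.card : ℝ) / d * log S.card with hq
  have hq0 : 0 ≤ q := by positivity
  obtain ⟨C, hCT, hCm, hC⟩ := step (⌊q⌋₊ + 1)
  refine ⟨C, hCT, ?_, ?_⟩
  · have hlt : ((S.filter fun x => ∀ y ∈ C, ¬ r x y).card : ℝ) < 1 := by
      refine hC.trans_lt ?_
      have h1 : (1 - t) ^ (⌊q⌋₊ + 1) ≤ exp (-(t * (⌊q⌋₊ + 1 : ℕ))) := by
        have := pow_le_pow_left₀ (by linarith) (one_sub_le_exp_neg t) (⌊q⌋₊ + 1)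
        rw [← exp_nat_mul] at this
        refine this.trans (le_of_eq ?_)
        congr 1; ring
      have h2 : log S.card < t * (⌊q⌋₊ + 1 : ℕ) := by
        have h3 : t * q = log S.card := by rw [hq, ht]; field_simp
        rw [← h3]
        push_cast
        exact mul_lt_mul_of_pos_left (Nat.lt_floor_add_one q) ht0
      calc (S.card : ℝ) * (1 - t) ^ (⌊q⌋₊ + 1) ≤ exp (log S.card) * exp (-(t * (⌊q⌋₊ + 1 : ℕ))) := by
            rw [exp_log hSR]; gcongr
        _ = exp (log S.card - t * (⌊q⌋₊ + 1 : ℕ)) := by rw [← exp_add]; rfl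
        _ < 1 := exp_lt_one_iff.2 (by linarith)
    have h0 : (S.filter fun x => ∀ y ∈ C, ¬ r x y).card = 0 := by
      have : (S.filter fun x => ∀ y ∈ C, ¬ r x y).card < 1 := by exact_mod_cast hlt
      omega
    intro x hx
    by_contra! hcon
    have := Finset.card_eq_zero.1 h0
    exact Finset.notMem_empty x (this ▸ Finset.mem_filter.2 ⟨hx, hcon⟩)
  · have : (C.card : ℝ) ≤ (⌊q⌋₊ + 1 : ℕ) := by exact_mod_cast hCm
    push_cast at this
    have := Nat.floor_le hq0
    linarith

end Cover

/-! ### The rate functional through entropies -/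

section RateInfo

variable {A : Type*} [Fintype A]

/-- The functional minimized in `rate`, in nats and written through entropies, so that it is
continuous on all of `A × A → ℝ`: mutual information plus expected log-mass. -/
noncomputable def rateInfo (M : A → ℝ) (μ : A × A → ℝ) : ℝ :=
  entropy (fun x => ∑ y, μ (x, y)) + entropy (sndMarginal μ) - entropy μ +
    ∑ y, sndMarginal μ y * log (M y)

theorem continuous_rateInfo (M : A → ℝ) : Continuous (rateInfo M) := by
  unfold rateInfo entropy sndMarginal
  have := continuous_negMulLog
  fun_prop

theorem logb_two_eq (x : ℝ) : logb 2 x = log x / log 2 := rfl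

theorem log_two_pos : 0 < log 2 := log_pos one_lt_two

theorem rateInfo_eq_sum (M : A → ℝ) (μ : A × A → ℝ) :
    rateInfo M μ = ∑ p : A × A, μ p *
      (log (μ p) - log (∑ y, μ (p.1, y)) - log (sndMarginal μ p.2) + log (M p.2)) := by
  have e0 : ∑ p, μ p * log (μ p) = -entropy μ := by
    simp [entropy, negMulLog]
  have e1 : ∑ p : A × A, μ p * log (∑ y, μ (p.1, y)) = -entropy fun x => ∑ y, μ (x, y) := by
    rw [Fintype.sum_prod_type, entropy, ← Finset.sum_neg_distrib]
    refine Finset.sum_congr rfl fun x _ => ?_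
    dsimp only
    rw [← Finset.sum_mul, negMulLog]
    ring
  have e2 : ∑ p : A × A, μ p * log (sndMarginal μ p.2) = -entropy (sndMarginal μ) := by
    rw [Fintype.sum_prod_type_right, entropy, ← Finset.sum_neg_distrib]
    refine Finset.sum_congr rfl fun y _ => ?_
    dsimp only
    rw [← Finset.sum_mul, negMulLog]
    simp [sndMarginal]
  have e3 : ∑ p : A × A, μ p * log (M p.2) = ∑ y, sndMarginal μ y * log (M y) := by
    rw [Fintype.sum_prod_type_right]
    simp only [sndMarginal, Finset.sum_mul]
  simp only [mul_add, mul_sub, Finset.sum_add_distrib, Finset.sum_sub_distrib]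
  rw [e0, e1, e2, e3, rateInfo]
  ring

theorem rate_summand_eq (M : A → ℝ) {ρ : A → A → ℝ} {D : ℝ} {Q : A → ℝ} {μ : A × A → ℝ}
    (hμ : μ ∈ couplings ρ D Q) :
    relEntropy μ (fun p => Q p.1 * sndMarginal μ p.2) +
      ((∑ y, sndMarginal μ y * logb 2 (M y) : ℝ) : EReal) =
    ((rateInfo M μ / log 2 : ℝ) : EReal) := by
  obtain ⟨⟨h0, -⟩, hQ, -⟩ := hμ
  have hx : ∀ p : A × A, μ p ≤ Q p.1 := fun p => by
    rw [← hQ]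
    exact Finset.single_le_sum (f := fun y => μ (p.1, y)) (fun y _ => h0 _) (Finset.mem_univ p.2)
  have hy : ∀ p : A × A, μ p ≤ sndMarginal μ p.2 := fun p =>
    Finset.single_le_sum (f := fun x => μ (x, p.2)) (fun x _ => h0 _) (Finset.mem_univ p.1)
  have hac : ∀ p : A × A, Q p.1 * sndMarginal μ p.2 = 0 → μ p = 0 := fun p hp => by
    rcases mul_eq_zero.1 hp with h | h
    · exact le_antisymm (h ▸ hx p) (h0 p)
    · exact le_antisymm (h ▸ hy p) (h0 p)
  have hterm : ∀ p : A × A, μ p * logb 2 (μ p / (Q p.1 * sndMarginal μ p.2)) =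
      (-negMulLog (μ p) - μ p * log (Q p.1) - μ p * log (sndMarginal μ p.2)) / log 2 := by
    intro p
    rcases (h0 p).eq_or_lt with h | h
    · simp [← h]
    · have h1 : Q p.1 ≠ 0 := (h.trans_le (hx p)).ne'
      have h2 : sndMarginal μ p.2 ≠ 0 := (h.trans_le (hy p)).ne'
      rw [logb_two_eq, log_div h.ne' (mul_ne_zero h1 h2), log_mul h1 h2, negMulLog]
      ring
  have hY : ∑ y, sndMarginal μ y * logb 2 (M y) = ∑ p : A × A, μ p * log (M p.2) / log 2 := by
    rw [Fintype.sum_prod_type_right]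
    refine Finset.sum_congr rfl fun y _ => ?_
    rw [logb_two_eq, sndMarginal, Finset.sum_mul]
    exact Finset.sum_congr rfl fun x _ => (mul_div_assoc _ _ _).symm
  rw [relEntropy, if_pos hac, ← EReal.coe_add, hY, ← Finset.sum_add_distrib, rateInfo_eq_sum,
    Finset.sum_div]
  congr 1
  refine Finset.sum_congr rfl fun p _ => ?_
  rw [hterm, hQ, negMulLog]
  ring

theorem rate_le_rateInfo (M : A → ℝ) {ρ : A → A → ℝ} {D : ℝ} {Q : A → ℝ} {μ : A × A → ℝ}
    (hμ : μ ∈ couplings ρ D Q) : rate ρ D Q M ≤ ((rateInfo M μ / log 2 : ℝ) : EReal) := by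
  rw [← rate_summand_eq M hμ]
  exact iInf₂_le μ hμ

theorem exists_rateInfo_lt_of_rate_lt {M : A → ℝ} {ρ : A → A → ℝ} {D r : ℝ} {Q : A → ℝ}
    (h : rate ρ D Q M < (r : EReal)) :
    ∃ μ ∈ couplings ρ D Q, rateInfo M μ < r * log 2 := by
  simp only [rate, iInf_lt_iff] at h
  obtain ⟨μ, hμ, h⟩ := h
  rw [rate_summand_eq M hμ, EReal.coe_lt_coe_iff, div_lt_iff₀ log_two_pos] at h
  exact ⟨μ, hμ, h⟩

end RateInfo

/-! ### Joint types and the type covering lemma -/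

section Joint

variable {A : Type*} {n : ℕ}

/-- The word over `A × A` formed by two words over `A`. -/
def pairWord (x y : Fin n → A) (i : Fin n) : A × A := (x i, y i)

theorem log_card_finset_word_le [Fintype A] (T : Finset (Fin n → A)) :
    log T.card ≤ n * log (Fintype.card A) := by
  rcases T.eq_empty_or_nonempty with rfl | hT
  · simp only [Finset.card_empty, Nat.cast_zero, log_zero]
    have := log_natCast_nonneg (Fintype.card A)
    positivity
  · rw [← log_pow]
    refine log_le_log (by exact_mod_cast hT.card_pos) ?_
    have := Finset.card_le_univ T
    rw [Fintype.card_fun, Fintype.card_fin] at this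
    exact_mod_cast this

variable [DecidableEq A] [Fintype A]

theorem sum_snd_typeCount_pairWord (x y : Fin n → A) (a : A) :
    ∑ b, typeCount (pairWord x y) (a, b) = typeCount x a := by
  rw [typeCount, Finset.card_eq_sum_card_fiberwise (f := y) (t := Finset.univ) (by simp)]
  simp [typeCount, pairWord, Finset.filter_filter]

theorem sum_fst_typeCount_pairWord (x y : Fin n → A) (b : A) :
    ∑ a, typeCount (pairWord x y) (a, b) = typeCount y b := by
  rw [typeCount, Finset.card_eq_sum_card_fiberwise (f := x) (t := Finset.univ) (by simp)]
  simp [typeCount, pairWord, Finset.filter_filter, and_comm]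

theorem sum_snd_empirical_pairWord (x y : Fin n → A) :
    (fun a => ∑ b, empirical (pairWord x y) (a, b)) = empirical x := by
  funext a
  unfold empirical
  rw [← Finset.sum_div, ← Nat.cast_sum, sum_snd_typeCount_pairWord]

theorem sndMarginal_empirical_pairWord (x y : Fin n → A) :
    sndMarginal (empirical (pairWord x y)) = empirical y := by
  funext b
  unfold sndMarginal empirical
  rw [← Finset.sum_div, ← Nat.cast_sum, sum_fst_typeCount_pairWord]

theorem distortion_eq_sum_typeCount (ρ : A → A → ℝ) (x y : Fin n → A) :
    distortion ρ x y =
      (1 / (n : ℝ)) * ∑ p : A × A, (typeCount (pairWord x y) p : ℝ) * ρ p.1 p.2 := by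
  rw [distortion, ← sum_apply_eq_sum_typeCount (pairWord x y) fun p => ρ p.1 p.2]
  rfl

theorem typeCount_right_eq {x y x' y' : Fin n → A}
    (h : typeCount (pairWord x y) = typeCount (pairWord x' y')) : typeCount y = typeCount y' := by
  funext b
  rw [← sum_fst_typeCount_pairWord x, ← sum_fst_typeCount_pairWord x', h]

theorem typeCount_left_eq {x y x' y' : Fin n → A}
    (h : typeCount (pairWord x y) = typeCount (pairWord x' y')) : typeCount x = typeCount x' := by
  funext a
  rw [← sum_snd_typeCount_pairWord x y, ← sum_snd_typeCount_pairWord x' y', h]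

/-- The conditional type class of `(x, y)` at `x'`: the words `y'` such that `(x', y')` has the
joint type of `(x, y)`. -/
def condTypeClass (x y x' : Fin n → A) : Finset (Fin n → A) :=
  Finset.univ.filter fun y' => typeCount (pairWord x' y') = typeCount (pairWord x y)

theorem mem_condTypeClass {x y x' y' : Fin n → A} :
    y' ∈ condTypeClass x y x' ↔ typeCount (pairWord x' y') = typeCount (pairWord x y) := by
  simp [condTypeClass]

/-- Conditional type classes at words of the same type have the same size, because the symmetric
group acts transitively on a type class. -/
theorem card_condTypeClass (x y : Fin n → A) {x' : Fin n → A} (hx' : x' ∈ typeClass x) :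
    (condTypeClass x y x').card = (condTypeClass x y x).card := by
  obtain ⟨σ, rfl⟩ := exists_perm_of_typeCount_eq (mem_typeClass.1 hx').symm
  refine (Finset.card_equiv (σ.symm.arrowCongr (Equiv.refl A)) fun y' => ?_).symm
  rw [mem_condTypeClass, mem_condTypeClass, ← typeCount_comp_perm (pairWord x y') σ]
  rfl

theorem card_typeClass_pairWord (x y : Fin n → A) :
    (typeClass (pairWord x y)).card = (typeClass x).card * (condTypeClass x y x).card := by
  have hfst : ∀ z ∈ typeClass (pairWord x y), (fun i => (z i).1) ∈ typeClass x := fun z hz => by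
    rw [mem_typeClass]
    exact typeCount_left_eq (y := fun i => (z i).2) (mem_typeClass.1 hz)
  rw [Finset.card_eq_sum_card_fiberwise (f := fun (z : Fin n → A × A) i => (z i).1)
    (t := typeClass x) hfst,
    ← smul_eq_mul]
  refine (Finset.sum_congr rfl fun x' hx' => ?_).trans (Finset.sum_const _)
  rw [← card_condTypeClass x y hx']
  refine Finset.card_bij' (fun z _ i => (z i).2) (fun y' _ => pairWord x' y') ?_ ?_ ?_ ?_
  · intro z hz
    rw [Finset.mem_filter, mem_typeClass] at hz
    rw [mem_condTypeClass, ← hz.1, ← hz.2]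
    rfl
  · intro y' hy'
    rw [Finset.mem_filter, mem_typeClass]
    exact ⟨mem_condTypeClass.1 hy', rfl⟩
  · intro z hz
    rw [← (Finset.mem_filter.1 hz).2]
    rfl
  · intro y' _
    rfl

theorem prod_apply_eq_exp {M : A → ℝ} (hM : ∀ a, 0 < M a) (y : Fin n → A) :
    ∏ i, M (y i) = exp (∑ b, (typeCount y b : ℝ) * log (M b)) := by
  rw [← sum_apply_eq_sum_typeCount y fun b => log (M b), exp_sum]
  exact Finset.prod_congr rfl fun i _ => (exp_log (hM _)).symm

theorem prodMass_eq_of_typeCount_eq {M : A → ℝ} (hM : ∀ a, 0 < M a) (y : Fin n → A)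
    {C : Finset (Fin n → A)} (hC : C ⊆ typeClass y) :
    prodMass M C = C.card * exp (∑ b, (typeCount y b : ℝ) * log (M b)) := by
  rw [prodMass, ← nsmul_eq_mul]
  refine (Finset.sum_congr rfl fun y' hy' => ?_).trans (Finset.sum_const _)
  rw [prod_apply_eq_exp hM, mem_typeClass.1 (hC hy')]

/-- Type covering lemma: the type class of `x` can be covered, with the joint type of `(x, y)`, by
a set of words whose mass is governed by `rateInfo` at that joint type, up to a factor polynomial
in `n`. -/
theorem exists_typeClass_cover (hn : 0 < n) {M : A → ℝ} (hM : ∀ a, 0 < M a) (x y : Fin n → A) :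
    ∃ C : Finset (Fin n → A),
      (∀ x' ∈ typeClass x, ∃ y' ∈ C, typeCount (pairWord x' y') = typeCount (pairWord x y)) ∧
      prodMass M C ≤ (n * log (Fintype.card A) + 1) *
        exp (n * rateInfo M (empirical (pairWord x y)) +
          (Fintype.card (A × A) + 2) * (log n + 1)) := by
  set d := (condTypeClass x y x).card with hd
  have hd0 : 0 < d := Finset.card_pos.2 ⟨y, mem_condTypeClass.2 rfl⟩
  have hsub : ∀ x', condTypeClass x y x' ⊆ typeClass y := fun x' y' hy' =>
    mem_typeClass.2 (typeCount_right_eq (mem_condTypeClass.1 hy'))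
  obtain ⟨C, hCT, hC, hcard⟩ := exists_small_cover (typeClass x) (typeClass y)
    (fun x' y' => typeCount (pairWord x' y') = typeCount (pairWord x y)) d hd0
    fun x' hx' => ⟨condTypeClass x y x', hsub x', fun y' hy' => mem_condTypeClass.1 hy',
      (card_condTypeClass x y hx').ge⟩
  refine ⟨C, hC, ?_⟩
  have hnR : (0 : ℝ) < n := by exact_mod_cast hn
  have hx0 : (0 : ℝ) < (typeClass x).card := by exact_mod_cast card_typeClass_pos x
  have hy0 : (0 : ℝ) < (typeClass y).card := by exact_mod_cast card_typeClass_pos y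
  have hdR : (0 : ℝ) < d := by exact_mod_cast hd0
  have hdle : (d : ℝ) ≤ (typeClass y).card := by exact_mod_cast Finset.card_le_card (hsub x)
  set K : ℝ := (typeClass y).card / d with hK
  have hK1 : 1 ≤ K := (one_le_div hdR).2 hdle
  have hlogA : 0 ≤ log (Fintype.card A : ℝ) := log_natCast_nonneg _
  have hc : (C.card : ℝ) ≤ (n * log (Fintype.card A) + 1) * K := by
    have := mul_le_mul_of_nonneg_left (log_card_finset_word_le (typeClass x))
      (zero_le_one.trans hK1)
    nlinarith
  have hj : log (typeClass (pairWord x y)).card = log (typeClass x).card + log d := by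
    rw [card_typeClass_pairWord, Nat.cast_mul, log_mul hx0.ne' hdR.ne']
  have hlogK : log K ≤ n * (entropy (empirical x) + entropy (empirical y) -
      entropy (empirical (pairWord x y))) + (Fintype.card (A × A) + 2) * (log n + 1) := by
    rw [hK, log_div hy0.ne' hdR.ne']
    have h1 := log_card_typeClass_le hn x
    have h2 := log_card_typeClass_le hn y
    have h3 := le_log_card_typeClass hn (pairWord x y)
    linarith
  have hlin : ∑ b, (typeCount y b : ℝ) * log (M b) =
      n * ∑ b, empirical y b * log (M b) := by
    rw [Finset.mul_sum]
    refine Finset.sum_congr rfl fun b _ => ?_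
    unfold empirical
    field_simp
  rw [prodMass_eq_of_typeCount_eq hM y hCT, rateInfo, sum_snd_empirical_pairWord,
    sndMarginal_empirical_pairWord, hlin]
  calc (C.card : ℝ) * exp (n * ∑ b, empirical y b * log (M b))
      ≤ ((n * log (Fintype.card A) + 1) * K) * exp (n * ∑ b, empirical y b * log (M b)) := by gcongr
    _ = (n * log (Fintype.card A) + 1) * exp (log K + n * ∑ b, empirical y b * log (M b)) := by
        rw [exp_add, exp_log (by positivity), mul_assoc]
    _ ≤ _ := by
        refine mul_le_mul_of_nonneg_left (exp_le_exp.2 ?_) (by positivity)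
        linarith

/-- A coupling `μ` of the type of `x` is within `|A| / n` of the joint type of `x` with some word
`y`, and `y` has no larger distortion: round `n μ` down and move what is left over to letters at
distortion zero. -/
theorem exists_word_near_coupling (hn : 0 < n) {ρ : A → A → ℝ} (hρ : ∀ x y, 0 ≤ ρ x y)
    (hρ0 : ∀ a, ∃ b, ρ a b = 0) {D : ℝ} (x : Fin n → A) {μ : A × A → ℝ}
    (hμ : μ ∈ couplings ρ D (empirical x)) :
    ∃ y : Fin n → A, distortion ρ x y ≤ D ∧
      ∀ p, |empirical (pairWord x y) p - μ p| ≤ Fintype.card A / n := by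
  obtain ⟨⟨h0, -⟩, hQ, hD⟩ := hμ
  choose g hg using hρ0
  have hnR : (0 : ℝ) < n := by exact_mod_cast hn
  set fl : A × A → ℕ := fun p => ⌊n * μ p⌋₊ with hfl
  have hfl_le : ∀ p, (fl p : ℝ) ≤ n * μ p := fun p => Nat.floor_le (mul_nonneg hnR.le (h0 p))
  have hfl_lt : ∀ p, n * μ p < fl p + 1 := fun p => Nat.lt_floor_add_one _
  have hrow : ∀ a, ∑ b, n * μ (a, b) = typeCount x a := fun a => by
    rw [← Finset.mul_sum, hQ, empirical]
    field_simp
  have hrow_le : ∀ a, ∑ b, fl (a, b) ≤ typeCount x a := fun a => by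
    have : ((∑ b, fl (a, b) : ℕ) : ℝ) ≤ typeCount x a := by
      rw [← hrow a, Nat.cast_sum]
      exact Finset.sum_le_sum fun b _ => hfl_le _
    exact_mod_cast this
  -- the surplus of row `a`
  set e : A → ℕ := fun a => typeCount x a - ∑ b, fl (a, b) with he
  have he_cast : ∀ a, (e a : ℝ) = typeCount x a - ∑ b, (fl (a, b) : ℝ) := fun a => by
    rw [he, Nat.cast_sub (hrow_le a), Nat.cast_sum]
  have he_le : ∀ a, (e a : ℝ) ≤ Fintype.card A := fun a => by
    rw [he_cast, ← hrow a, ← Finset.sum_sub_distrib]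
    refine (Finset.sum_le_sum (g := fun _ => (1 : ℝ)) fun b _ => ?_).trans (by simp)
    have := hfl_lt (a, b)
    linarith
  set j : A × A → ℕ := fun p => fl p + if p.2 = g p.1 then e p.1 else 0 with hj
  have hjrow : ∀ a, ∑ b, j (a, b) = typeCount x a := fun a => by
    simp only [hj, Finset.sum_add_distrib, Finset.sum_ite_eq', Finset.mem_univ, if_true, he]
    have := hrow_le a
    omega
  have hjsum : ∑ p, j p = n := by
    rw [Fintype.sum_prod_type]
    simp only [hjrow, sum_typeCount]
  obtain ⟨z, hz⟩ := exists_typeCount_eq j hjsum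
  have hzx : typeCount (fun i => (z i).1) = typeCount x := by
    funext a
    rw [← sum_snd_typeCount_pairWord _ fun i => (z i).2, ← hjrow a, ← hz]
    rfl
  obtain ⟨σ, hσ⟩ := exists_perm_of_typeCount_eq hzx
  have hxy : typeCount (pairWord x fun i => (z (σ i)).2) = j := by
    rw [← hz, ← typeCount_comp_perm z σ, ← hσ]
    rfl
  refine ⟨fun i => (z (σ i)).2, ?_, fun p => ?_⟩
  · rw [distortion_eq_sum_typeCount, hxy, one_div, inv_mul_le_iff₀ hnR]
    refine le_trans ?_ (mul_le_mul_of_nonneg_left hD hnR.le)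
    rw [Finset.mul_sum]
    refine Finset.sum_le_sum fun p _ => ?_
    have h1 := mul_le_mul_of_nonneg_right (hfl_le p) (hρ p.1 p.2)
    simp only [hj]
    split_ifs with h
    · rw [h, hg] at *
      simp
    · simp only [add_zero]
      linarith
  · rw [empirical, hxy, show ((j p : ℕ) : ℝ) / n - μ p = (j p - n * μ p) / n by field_simp,
      abs_div, abs_of_pos hnR]
    refine div_le_div_of_nonneg_right ?_ hnR.le
    have hA : (1 : ℝ) ≤ Fintype.card A := by
      exact_mod_cast Fintype.card_pos_iff.2 ⟨p.1⟩
    have h1 := hfl_le p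
    have h2 := hfl_lt p
    have h3 := he_le p.1
    have h4 : (0 : ℝ) ≤ e p.1 := Nat.cast_nonneg _
    rw [abs_le]
    simp only [hj]
    split_ifs <;> push_cast <;> constructor <;> linarith

/-- The covering cost of the type classes of rate at most `R`, uniformly over the types. -/
theorem eventually_exists_cover_of_rate_le {M : A → ℝ} (hM : ∀ a, 0 < M a) {ρ : A → A → ℝ}
    (hρ : ∀ x y, 0 ≤ ρ x y) (hρ0 : ∀ a, ∃ b, ρ a b = 0) (D R : ℝ) {δ : ℝ} (hδ : 0 < δ) :
    ∀ᶠ n : ℕ in atTop, ∀ x : Fin n → A, rate ρ D (empirical x) M ≤ (R : EReal) →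
      ∃ C : Finset (Fin n → A), typeClass x ⊆ blowup ρ D C ∧
        prodMass M C ≤ (n * log (Fintype.card A) + 1) *
          exp (n * (R * log 2 + δ) + (Fintype.card (A × A) + 2) * (log n + 1)) := by
  have hunif := (isCompact_stdSimplex ℝ (A × A)).uniformContinuousOn_of_continuous
    (continuous_rateInfo M).continuousOn
  obtain ⟨η, hη, hclose⟩ := Metric.uniformContinuousOn_iff.1 hunif (δ / 2) (half_pos hδ)
  have hlim : Tendsto (fun n : ℕ => (Fintype.card A : ℝ) / n) atTop (nhds 0) :=
    tendsto_const_div_atTop_nhds_zero_nat _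
  filter_upwards [hlim.eventually (gt_mem_nhds hη), eventually_gt_atTop 0] with n hnη hn x hx
  have hlog2 := log_two_pos
  have hx' : rate ρ D (empirical x) M < ((R + δ / 2 / log 2 : ℝ) : EReal) :=
    hx.trans_lt (EReal.coe_lt_coe_iff.2 (by linarith [div_pos (half_pos hδ) hlog2]))
  obtain ⟨μ, hμ, hμR⟩ := exists_rateInfo_lt_of_rate_lt hx'
  obtain ⟨y, hyD, hy⟩ := exists_word_near_coupling hn hρ hρ0 x hμ
  obtain ⟨C, hC, hCM⟩ := exists_typeClass_cover hn hM x y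
  refine ⟨C, fun x' hx' => ?_, hCM.trans ?_⟩
  · obtain ⟨y', hy', h⟩ := hC x' hx'
    refine Finset.mem_filter.2 ⟨Finset.mem_univ _, y', hy', ?_⟩
    rwa [distortion_eq_sum_typeCount, h, ← distortion_eq_sum_typeCount]
  · have h1 := hclose _ (empirical_mem_stdSimplex hn (pairWord x y)) μ hμ.1
      ((dist_pi_lt_iff hη).2 fun p => (hy p).trans_lt hnη)
    rw [Real.dist_eq, abs_lt] at h1
    rw [add_mul, div_mul_cancel₀ _ hlog2.ne'] at hμR
    have hlogA : 0 ≤ log (Fintype.card A : ℝ) := log_natCast_nonneg _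
    gcongr
    linarith

end Joint

/-! ### Product masses and Gibbs' inequality -/

section ProductMass

variable {A : Type*} {n : ℕ}

theorem prodMass_mono {m : A → ℝ} (hm : ∀ a, 0 ≤ m a) {C C' : Finset (Fin n → A)} (h : C ⊆ C') :
    prodMass m C ≤ prodMass m C' :=
  Finset.sum_le_sum_of_subset_of_nonneg h fun _ _ _ => Finset.prod_nonneg fun _ _ => hm _

theorem prodMass_nonneg {m : A → ℝ} (hm : ∀ a, 0 ≤ m a) (C : Finset (Fin n → A)) :
    0 ≤ prodMass m C :=
  Finset.sum_nonneg fun _ _ => Finset.prod_nonneg fun _ _ => hm _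

theorem prodMass_pos {m : A → ℝ} (hm : ∀ a, 0 < m a) {C : Finset (Fin n → A)} (hC : C.Nonempty) :
    0 < prodMass m C :=
  Finset.sum_pos (fun _ _ => Finset.prod_pos fun _ _ => hm _) hC

theorem distortion_le_of_le (hn : 0 < n) {ρ : A → A → ℝ} {B : ℝ} (hB : ∀ x y, ρ x y ≤ B)
    (x y : Fin n → A) : distortion ρ x y ≤ B := by
  have hnR : (0 : ℝ) < n := by exact_mod_cast hn
  rw [distortion, one_div, inv_mul_le_iff₀ hnR]
  refine (Finset.sum_le_sum fun i _ => hB (x i) (y i)).trans (by simp)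

theorem prodMass_biUnion_le [DecidableEq A] {m : A → ℝ} (hm : ∀ a, 0 ≤ m a) {ι : Type*}
    (s : Finset ι) (C : ι → Finset (Fin n → A)) :
    prodMass m (s.biUnion C) ≤ ∑ i ∈ s, prodMass m (C i) := by
  classical
  induction s using Finset.induction_on with
  | empty => simp [prodMass]
  | insert i s hi ih =>
    rw [Finset.biUnion_insert, Finset.sum_insert hi]
    have h : prodMass m (C i ∪ s.biUnion C) + prodMass m (C i ∩ s.biUnion C) = _ :=
      Finset.sum_union_inter
    have h0 := prodMass_nonneg hm (C i ∩ s.biUnion C)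
    unfold prodMass at *
    linarith

variable [Fintype A]

theorem mem_blowup {ρ : A → A → ℝ} {D : ℝ} {C : Finset (Fin n → A)} {x : Fin n → A} :
    x ∈ blowup ρ D C ↔ ∃ y ∈ C, distortion ρ x y ≤ D := by
  simp [blowup]

theorem sum_prod_apply (f : A → ℝ) : ∑ x : Fin n → A, ∏ i, f (x i) = (∑ a, f a) ^ n :=
  (Fintype.sum_pow f n).symm

theorem prodMass_compl [DecidableEq A] {Q : A → ℝ} (hQ : Q ∈ stdSimplex ℝ A)
    (C : Finset (Fin n → A)) : prodMass Q Cᶜ = 1 - prodMass Q C := by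
  have h := Finset.sum_add_sum_compl C fun x => ∏ i, Q (x i)
  rw [sum_prod_apply, hQ.2, one_pow] at h
  unfold prodMass
  linarith

/-- Under the product law every coordinate has law `Q`. -/
theorem sum_prod_mul_apply {Q : A → ℝ} (hQ : ∑ a, Q a = 1) (i : Fin n) (g : A → ℝ) :
    ∑ x : Fin n → A, (∏ k, Q (x k)) * g (x i) = ∑ a, Q a * g a := by
  have h := Finset.prod_univ_sum (fun _ : Fin n => (Finset.univ : Finset A))
    fun k a => Q a * if k = i then g a else 1
  rw [Fintype.piFinset_univ] at h
  have hl : ∏ k : Fin n, ∑ a, Q a * (if k = i then g a else 1) = ∑ a, Q a * g a := by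
    rw [Finset.prod_eq_single i]
    · simp
    · intro k _ hk
      simp [hk, hQ]
    · simp
  rw [← hl, h]
  refine Finset.sum_congr rfl fun x _ => ?_
  rw [Finset.prod_mul_distrib, Finset.prod_ite_eq']
  simp

theorem sum_prod_mul_empirical [DecidableEq A] (hn : 0 < n) {Q : A → ℝ} (hQ : ∑ a, Q a = 1)
    (a : A) : ∑ x : Fin n → A, (∏ k, Q (x k)) * empirical x a = Q a := by
  have hnR : (n : ℝ) ≠ 0 := by exact_mod_cast hn.ne'
  have h : ∀ x : Fin n → A, empirical x a = (∑ i, if x i = a then (1 : ℝ) else 0) / n := by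
    intro x
    simp [empirical, typeCount]
  simp only [h, ← mul_div_assoc, Finset.mul_sum]
  rw [← Finset.sum_div, Finset.sum_comm]
  simp only [sum_prod_mul_apply hQ _ fun b => if b = a then (1 : ℝ) else 0]
  simp
  field_simp

/-- Gibbs' inequality in the form of Jensen's inequality for the logarithm. -/
theorem sum_mul_log_div_le {ι : Type*} (s : Finset ι) (q w : ι → ℝ) (hq : ∀ i ∈ s, 0 ≤ q i)
    (hq1 : ∑ i ∈ s, q i = 1) (hw : ∀ i ∈ s, 0 ≤ w i) (hqw : ∀ i ∈ s, 0 < q i → 0 < w i) :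
    ∑ i ∈ s, q i * log (w i / q i) ≤ log (∑ i ∈ s, w i) := by
  set W := ∑ i ∈ s, w i with hW
  have hW0 : 0 < W := by
    obtain ⟨i, hi, h⟩ := Finset.exists_ne_zero_of_sum_ne_zero (hq1 ▸ one_ne_zero)
    exact (hqw i hi ((hq i hi).lt_of_ne' h)).trans_le (Finset.single_le_sum hw hi)
  have h : ∀ i ∈ s, q i * log (w i / q i) ≤ w i / W - q i + q i * log W := by
    intro i hi
    rcases (hq i hi).eq_or_lt with h0 | h0
    · have := div_nonneg (hw i hi) hW0.le
      simp [← h0, this]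
    · have hw0 := hqw i hi h0
      have h1 := log_le_sub_one_of_pos (div_pos (div_pos hw0 h0) hW0)
      rw [log_div (div_pos hw0 h0).ne' hW0.ne'] at h1
      have h2 := mul_le_mul_of_nonneg_left h1 h0.le
      have h3 : q i * (w i / q i / W - 1) = w i / W - q i := by field_simp
      linarith
  refine (Finset.sum_le_sum h).trans (le_of_eq ?_)
  rw [Finset.sum_add_distrib, Finset.sum_sub_distrib, ← Finset.sum_div, ← Finset.sum_mul, hq1,
    ← hW, div_self hW0.ne']
  ring

end ProductMass

/-! ### The single-letter converse and the change of measure -/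

section Converse

variable {A : Type*} [Fintype A] {n : ℕ}

/-- Single-letter converse: if `C` covers `Q^n`-mass at least `1 - ε`, then the averaged
single-letter joint law `μ` of `X^n ∼ Q^n` and its quantization in `C` is an admissible coupling at
a slightly larger distortion, and its cost bounds the mass of `C` from below. With the reverse
channel `V(a|b) = μ(a, b) / μ_Y(b)`, the cost is the `Q^n`-mean of `log (V^n M^n / Q^n)`, so that one
application of Gibbs' inequality suffices. -/
theorem exists_coupling_le_log_prodMass (hn : 0 < n) {M : A → ℝ} (hM : ∀ a, 0 < M a)
    {ρ : A → A → ℝ} {B : ℝ} (hB0 : 0 ≤ B) (hB : ∀ x y, ρ x y ≤ B) {D : ℝ} (hD : 0 ≤ D)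
    {Q : A → ℝ} (hQ : Q ∈ stdSimplex ℝ A) {ε : ℝ}
    {C : Finset (Fin n → A)} (hCne : C.Nonempty) (hC : 1 - ε ≤ prodMass Q (blowup ρ D C)) :
    ∃ μ ∈ couplings ρ (D + ε * B) Q, n * rateInfo M μ ≤ log (prodMass M C) := by
  classical
  have hnR : (0 : ℝ) < n := by exact_mod_cast hn
  obtain ⟨y₀, hy₀⟩ := hCne
  have hf : ∀ x : Fin n → A, ∃ y ∈ C, x ∈ blowup ρ D C → distortion ρ x y ≤ D := fun x => by
    by_cases hx : x ∈ blowup ρ D C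
    · obtain ⟨y, hy, h⟩ := mem_blowup.1 hx
      exact ⟨y, hy, fun _ => h⟩
    · exact ⟨y₀, hy₀, fun h => absurd h hx⟩
  choose f hfC hfD using hf
  set q : (Fin n → A) → ℝ := fun x => ∏ i, Q (x i) with hq
  have hq0 : ∀ x, 0 ≤ q x := fun x => Finset.prod_nonneg fun i _ => hQ.1 _
  have hq1 : ∑ x, q x = 1 := by rw [hq, sum_prod_apply, hQ.2, one_pow]
  set μ : A × A → ℝ := fun p => ∑ x, q x * empirical (pairWord x (f x)) p with hμ
  have hemp : ∀ (x : Fin n → A) p, 0 ≤ empirical (pairWord x (f x)) p := fun x =>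
    (empirical_mem_stdSimplex hn _).1
  have hμ0 : ∀ p, 0 ≤ μ p := fun p => Finset.sum_nonneg fun x _ => mul_nonneg (hq0 x) (hemp x p)
  -- `μ`-means are `Q^n`-means of empirical means
  have hmean : ∀ g : A × A → ℝ, n * ∑ p, μ p * g p = ∑ x, q x * ∑ i, g (x i, f x i) := by
    intro g
    simp only [hμ, Finset.sum_mul, Finset.mul_sum]
    rw [Finset.sum_comm]
    refine Finset.sum_congr rfl fun x _ => ?_
    have h1 := sum_apply_eq_sum_typeCount (pairWord x (f x)) g
    have h2 : ∑ i, q x * g (x i, f x i) =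
        q x * ∑ p, (typeCount (pairWord x (f x)) p : ℝ) * g p := by
      rw [← Finset.mul_sum, ← h1]
      rfl
    rw [h2, Finset.mul_sum]
    refine Finset.sum_congr rfl fun p _ => ?_
    unfold empirical
    field_simp
  have hfst : ∀ a, ∑ b, μ (a, b) = Q a := by
    intro a
    rw [← sum_prod_mul_empirical hn hQ.2 a]
    simp only [hμ]
    rw [Finset.sum_comm]
    refine Finset.sum_congr rfl fun x _ => ?_
    rw [← Finset.mul_sum, ← sum_snd_empirical_pairWord x (f x)]
  have hμ1 : ∑ p, μ p = 1 := by
    rw [Fintype.sum_prod_type]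
    simp only [hfst, hQ.2]
  have hdist : ∑ p, μ p * ρ p.1 p.2 ≤ D + ε * B := by
    have h1 : ∑ p, μ p * ρ p.1 p.2 = ∑ x, q x * distortion ρ x (f x) := by
      have := hmean fun p => ρ p.1 p.2
      rw [eq_comm, ← mul_right_inj' hnR.ne', this, Finset.mul_sum]
      refine Finset.sum_congr rfl fun x _ => ?_
      unfold distortion
      field_simp
    have h2 : ∑ x ∈ (blowup ρ D C)ᶜ, q x ≤ ε := by
      have : ∑ x ∈ (blowup ρ D C)ᶜ, q x = _ := prodMass_compl hQ (blowup ρ D C)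
      linarith
    have h3 : ∑ x ∈ blowup ρ D C, q x ≤ 1 := by
      rw [← hq1]
      exact Finset.sum_le_sum_of_subset_of_nonneg (Finset.subset_univ _) fun x _ _ => hq0 x
    rw [h1, ← Finset.sum_add_sum_compl (blowup ρ D C)]
    have h4 : ∑ x ∈ blowup ρ D C, q x * distortion ρ x (f x) ≤
        (∑ x ∈ blowup ρ D C, q x) * D := by
      rw [Finset.sum_mul]
      exact Finset.sum_le_sum fun x hx => mul_le_mul_of_nonneg_left (hfD x hx) (hq0 x)
    have h5 : ∑ x ∈ (blowup ρ D C)ᶜ, q x * distortion ρ x (f x) ≤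
        (∑ x ∈ (blowup ρ D C)ᶜ, q x) * B := by
      rw [Finset.sum_mul]
      exact Finset.sum_le_sum fun x _ =>
        mul_le_mul_of_nonneg_left (distortion_le_of_le hn hB _ _) (hq0 x)
    nlinarith
  refine ⟨μ, ⟨⟨hμ0, hμ1⟩, hfst, hdist⟩, ?_⟩
  -- the reverse channel
  set V : A → A → ℝ := fun a b => μ (a, b) / sndMarginal μ b with hV
  have hY0 : ∀ b, 0 ≤ sndMarginal μ b := fun b => Finset.sum_nonneg fun a _ => hμ0 _
  have hV0 : ∀ a b, 0 ≤ V a b := fun a b => div_nonneg (hμ0 _) (hY0 b)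
  have hV1 : ∀ b, ∑ a, V a b ≤ 1 := fun b => by
    simp only [hV]
    rw [← Finset.sum_div]
    exact div_self_le_one _
  set w : (Fin n → A) → (Fin n → A) → ℝ := fun x y => ∏ i, (V (x i) (y i) * M (y i)) with hw
  have hw0 : ∀ x y, 0 ≤ w x y := fun x y =>
    Finset.prod_nonneg fun i _ => mul_nonneg (hV0 _ _) (hM _).le
  have hpos : ∀ x, 0 < q x → ∀ i, 0 < Q (x i) ∧ 0 < μ (x i, f x i) ∧
      0 < sndMarginal μ (f x i) := by
    intro x hx i
    have h1 : 0 < Q (x i) := (hQ.1 _).lt_of_ne' fun h =>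
      hx.ne' (Finset.prod_eq_zero (Finset.mem_univ i) h)
    have h2 : 0 < empirical (pairWord x (f x)) (x i, f x i) := by
      refine div_pos ?_ hnR
      exact_mod_cast Finset.card_pos.2 ⟨i, by simp [pairWord]⟩
    have h3 : 0 < μ (x i, f x i) := (mul_pos hx h2).trans_le
      (Finset.single_le_sum (f := fun x => q x * empirical (pairWord x (f x)) _)
        (fun x _ => mul_nonneg (hq0 x) (hemp x _)) (Finset.mem_univ x))
    refine ⟨h1, h3, h3.trans_le ?_⟩
    exact Finset.single_le_sum (f := fun a => μ (a, f x i)) (fun a _ => hμ0 _)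
      (Finset.mem_univ (x i))
  have hcost : n * rateInfo M μ = ∑ x, q x * log (w x (f x) / q x) := by
    rw [rateInfo_eq_sum, hmean fun p =>
      log (μ p) - log (∑ y, μ (p.1, y)) - log (sndMarginal μ p.2) + log (M p.2)]
    refine Finset.sum_congr rfl fun x _ => ?_
    rcases (hq0 x).eq_or_lt with h | h
    · simp [← h]
    · have hp := hpos x h
      congr 1
      rw [hw, hq, ← Finset.prod_div_distrib, log_prod]
      · refine Finset.sum_congr rfl fun i _ => ?_
        obtain ⟨h1, h2, h3⟩ := hp i
        have h4 := hM (f x i)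
        rw [hfst, hV, log_div (by positivity) h1.ne', log_mul (by positivity) h4.ne',
          log_div h2.ne' h3.ne']
        ring
      · intro i _
        obtain ⟨h1, h2, h3⟩ := hp i
        have h4 := hM (f x i)
        simp only [hV]
        positivity
  have hwpos : ∀ x, 0 < q x → 0 < w x (f x) := fun x hx =>
    Finset.prod_pos fun i _ => mul_pos (div_pos (hpos x hx i).2.1 (hpos x hx i).2.2) (hM _)
  have hsum : ∑ x, w x (f x) ≤ prodMass M C := by
    rw [← Finset.sum_fiberwise_of_maps_to (t := C) (g := f) fun x _ => hfC x]
    refine Finset.sum_le_sum fun y _ => ?_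
    calc ∑ x with f x = y, w x (f x) = ∑ x with f x = y, w x y :=
          Finset.sum_congr rfl fun x hx => by rw [(Finset.mem_filter.1 hx).2]
      _ ≤ ∑ x, w x y := Finset.sum_le_sum_of_subset_of_nonneg (Finset.filter_subset _ _)
          fun x _ _ => hw0 x y
      _ = ∏ i, ∑ a, V a (y i) * M (y i) := by
          rw [Finset.prod_univ_sum, Fintype.piFinset_univ]
      _ ≤ ∏ i, M (y i) := by
          refine Finset.prod_le_prod
            (fun i _ => Finset.sum_nonneg fun a _ => mul_nonneg (hV0 _ _) (hM _).le) fun i _ => ?_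
          rw [← Finset.sum_mul]
          exact mul_le_of_le_one_left (hM _).le (hV1 _)
  have hS0 : 0 < ∑ x, w x (f x) := by
    obtain ⟨x, -, hx⟩ := Finset.exists_ne_zero_of_sum_ne_zero (hq1 ▸ one_ne_zero)
    exact (hwpos x ((hq0 x).lt_of_ne' hx)).trans_le
      (Finset.single_le_sum (f := fun x => w x (f x)) (fun x _ => hw0 _ _) (Finset.mem_univ x))
  rw [hcost]
  exact (sum_mul_log_div_le Finset.univ q (fun x => w x (f x)) (fun x _ => hq0 x) hq1
    (fun x _ => hw0 _ _) fun x _ => hwpos x).trans (log_le_log hS0 hsum)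

/-- A strict lower bound on the rate at distortion `D` persists at slightly larger distortion, by
compactness of the set of couplings. -/
theorem exists_gap_of_lt_rate {M : A → ℝ} {ρ : A → A → ℝ} {D R : ℝ} {Q : A → ℝ}
    (h : (R : EReal) < rate ρ D Q M) :
    ∃ r : ℝ, R < r ∧ ∃ η > 0, ∀ μ ∈ couplings ρ (D + η) Q, r * log 2 < rateInfo M μ := by
  obtain ⟨r, hRr, hr⟩ := EReal.lt_iff_exists_real_btwn.1 h
  refine ⟨r, EReal.coe_lt_coe_iff.1 hRr, ?_⟩
  set K : Set (A × A → ℝ) := stdSimplex ℝ (A × A) ∩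
    ({μ | ∀ x, ∑ y, μ (x, y) = Q x} ∩ {μ | rateInfo M μ ≤ r * log 2}) with hK
  have hKc : IsCompact K := by
    refine (isCompact_stdSimplex ℝ (A × A)).inter_right (IsClosed.inter ?_ ?_)
    · simp only [Set.ofPred_forall]
      exact isClosed_iInter fun x => isClosed_eq (by fun_prop) continuous_const
    · exact isClosed_le (continuous_rateInfo M) continuous_const
  rcases K.eq_empty_or_nonempty with hKe | hKne
  · refine ⟨1, one_pos, fun μ hμ => ?_⟩
    by_contra! hcon
    exact Set.notMem_empty μ (hKe ▸ ⟨hμ.1, hμ.2.1, hcon⟩)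
  · have hcont : Continuous fun μ : A × A → ℝ => ∑ p, μ p * ρ p.1 p.2 := by fun_prop
    obtain ⟨μ₀, hμ₀, hmin⟩ := hKc.exists_isMinOn hKne hcont.continuousOn
    have hlt : D < ∑ p, μ₀ p * ρ p.1 p.2 := by
      by_contra! hcon
      have h1 := hr.trans_le (rate_le_rateInfo M (ρ := ρ) ⟨hμ₀.1, hμ₀.2.1, hcon⟩)
      rw [EReal.coe_lt_coe_iff, lt_div_iff₀ log_two_pos] at h1
      exact h1.not_ge hμ₀.2.2
    refine ⟨(∑ p, μ₀ p * ρ p.1 p.2 - D) / 2, by linarith, fun μ hμ => ?_⟩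
    by_contra! hcon
    have h1 : ∑ p, μ₀ p * ρ p.1 p.2 ≤ ∑ p, μ p * ρ p.1 p.2 := hmin ⟨hμ.1, hμ.2.1, hcon⟩
    have h2 := hμ.2.2
    linarith

/-- Relative entropy in nats. -/
noncomputable def klNat (Q P : A → ℝ) : ℝ := ∑ a, Q a * log (Q a / P a)

theorem relEntropy_eq_klNat {P : A → ℝ} (hP : ∀ a, 0 < P a) (Q : A → ℝ) :
    relEntropy Q P = ((klNat Q P / log 2 : ℝ) : EReal) := by
  rw [relEntropy, if_pos fun a h => absurd h (hP a).ne', klNat, Finset.sum_div]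
  simp only [logb_two_eq, mul_div_assoc]

/-- Change of measure: a set whose `Q^n`-mass stays bounded below has `P^n`-mass at least
`exp (-n (H(Q‖P) + δ))`. The log-likelihood ratio is controlled by a Chernoff bound. -/
theorem eventually_exp_le_prodMass {P : A → ℝ} (hP : ∀ a, 0 < P a) {Q : A → ℝ}
    (hQ : Q ∈ stdSimplex ℝ A) {δ ε : ℝ} (hδ : 0 < δ) (hε : 0 < ε) :
    ∀ᶠ n : ℕ in atTop, ∀ U : Finset (Fin n → A), ε ≤ prodMass Q U →
      exp (-(n * (klNat Q P + δ))) ≤ prodMass P U := by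
  classical
  set g : A → ℝ := fun a => log (Q a / P a) - (klNat Q P + δ / 2) with hg
  have hgmean : ∑ a, Q a * g a = -(δ / 2) := by
    simp only [hg, mul_sub, Finset.sum_sub_distrib, ← Finset.sum_mul, hQ.2]
    rw [klNat]
    ring
  set φ : ℝ → ℝ := fun s => ∑ a, Q a * exp (s * g a) with hφ
  have hφ0 : φ 0 = 1 := by simp [hφ, hQ.2]
  have hφd : HasDerivAt φ (-(δ / 2)) 0 := by
    rw [← hgmean]
    refine HasDerivAt.fun_sum fun a _ => ?_
    have h := ((hasDerivAt_id (0 : ℝ)).mul_const (g a)).exp.const_mul (Q a)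
    simpa using h
  -- the moment generating function drops below one, since its slope at zero is negative
  obtain ⟨s, hs0, hs1⟩ : ∃ s > 0, φ s < 1 := by
    have h := (hasDerivAt_iff_tendsto_slope.1 hφd).mono_left
      (nhdsWithin_mono 0 (fun s (hs : s ∈ Set.Ioi (0 : ℝ)) => (Set.mem_Ioi.1 hs).ne'))
    have h2 := h.eventually (gt_mem_nhds (show -(δ / 2) < 0 by linarith))
    obtain ⟨s, hs, hs0⟩ := (h2.and self_mem_nhdsWithin).exists
    refine ⟨s, hs0, ?_⟩
    rw [slope_def_field, hφ0, sub_zero] at hs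
    have := (div_neg_iff.1 hs).resolve_left fun h => absurd h.2 (not_lt.2 (le_of_lt hs0))
    linarith [this.1]
  have hφnn : 0 ≤ φ s := Finset.sum_nonneg fun a _ => mul_nonneg (hQ.1 a) (exp_pos _).le
  have hlim1 := tendsto_pow_atTop_nhds_zero_of_lt_one hφnn hs1
  have hlim2 := tendsto_pow_atTop_nhds_zero_of_lt_one (exp_pos (-(δ / 2))).le
    (exp_lt_one_iff.2 (by linarith : -(δ / 2) < 0))
  filter_upwards [hlim1.eventually (gt_mem_nhds (half_pos hε)),
    hlim2.eventually (gt_mem_nhds (half_pos hε))] with n hn1 hn2 U hU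
  have hq0 : ∀ x : Fin n → A, 0 ≤ ∏ i, Q (x i) := fun x => Finset.prod_nonneg fun i _ => hQ.1 _
  set T : Finset (Fin n → A) := U.filter fun x => ∑ i, g (x i) ≤ 0 with hT
  have hsplit : ∑ x ∈ T, ∏ i, Q (x i) +
      ∑ x ∈ U.filter (fun x => ¬ ∑ i, g (x i) ≤ 0), ∏ i, Q (x i) = prodMass Q U :=
    Finset.sum_filter_add_sum_filter_not U (fun x => ∑ i, g (x i) ≤ 0) _
  have htail : ∑ x ∈ U.filter (fun x => ¬ ∑ i, g (x i) ≤ 0), ∏ i, Q (x i) ≤ φ s ^ n := by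
    rw [hφ, ← sum_prod_apply (n := n) fun a => Q a * exp (s * g a)]
    refine (Finset.sum_le_sum fun x hx => ?_).trans
      (Finset.sum_le_sum_of_subset_of_nonneg (Finset.subset_univ _) fun x _ _ =>
        Finset.prod_nonneg fun i _ => mul_nonneg (hQ.1 _) (exp_pos _).le)
    rw [Finset.prod_mul_distrib, ← exp_sum, ← Finset.mul_sum]
    have hx2 := not_le.1 (Finset.mem_filter.1 hx).2
    exact le_mul_of_one_le_right (hq0 x) (one_le_exp (mul_nonneg hs0.le hx2.le))
  have hbulk : ∑ x ∈ T, ∏ i, Q (x i) ≤ prodMass P U * exp (n * (klNat Q P + δ / 2)) := by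
    refine le_trans ?_ (mul_le_mul_of_nonneg_right
      (prodMass_mono (fun a => (hP a).le) (Finset.filter_subset (fun x => ∑ i, g (x i) ≤ 0) U)) (exp_pos _).le)
    rw [prodMass, Finset.sum_mul]
    refine Finset.sum_le_sum fun x hx => ?_
    have hP0 : 0 < ∏ i, P (x i) := Finset.prod_pos fun i _ => hP _
    rcases (hq0 x).eq_or_lt with h | h
    · rw [← h]; positivity
    · have hQi : ∀ i, 0 < Q (x i) := fun i => (hQ.1 _).lt_of_ne' fun h0 =>
        h.ne' (Finset.prod_eq_zero (Finset.mem_univ i) h0)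
      have hx2 : ∑ i, g (x i) ≤ 0 := (Finset.mem_filter.1 hx).2
      simp only [hg, Finset.sum_sub_distrib, Finset.sum_const, Finset.card_univ, Fintype.card_fin,
        nsmul_eq_mul] at hx2
      have h1 : ∏ i, Q (x i) = (∏ i, P (x i)) * exp (∑ i, log (Q (x i) / P (x i))) := by
        rw [exp_sum, ← Finset.prod_mul_distrib]
        refine Finset.prod_congr rfl fun i _ => ?_
        rw [exp_log (div_pos (hQi i) (hP _)), mul_div_cancel₀ _ (hP _).ne']
      rw [h1]
      gcongr
      linarith
  have hge : ε / 2 ≤ prodMass P U * exp (n * (klNat Q P + δ / 2)) := by linarith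
  rw [← exp_nat_mul] at hn2
  have h3 : exp (-(n * (klNat Q P + δ))) * exp (n * (klNat Q P + δ / 2)) =
      exp (n * -(δ / 2)) := by
    rw [← exp_add]
    congr 1
    ring
  have h4 : exp (-(n * (klNat Q P + δ))) * exp (n * (klNat Q P + δ / 2)) ≤
      prodMass P U * exp (n * (klNat Q P + δ / 2)) := by
    rw [h3]; linarith
  exact le_of_mul_le_mul_right h4 (exp_pos _)

end Converse

/-! ### Asymptotics -/

section Asymptotics

theorem eventually_poly_mul_exp_log_le_exp (a : ℕ) {b c δ : ℝ} (hb : 0 ≤ b) (hc : 0 ≤ c)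
    (hδ : 0 < δ) :
    ∀ᶠ n : ℕ in atTop,
      ((n : ℝ) + 1) ^ a * (n * c + 1) * exp (b * (log n + 1)) ≤ exp (n * δ) := by
  set K : ℝ := a + 1 + b with hK
  have hK0 : 0 < K := by positivity
  have hlim : Tendsto (fun n : ℕ => (n : ℝ) + 1) atTop atTop :=
    tendsto_atTop_add_const_right _ _ tendsto_natCast_atTop_atTop
  have h1 := (isLittleO_log_id_atTop.comp_tendsto hlim).bound (show 0 < δ / (2 * K) by positivity)
  have h2 := (tendsto_natCast_atTop_atTop (R := ℝ)).eventually_ge_atTop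
    ((log (c + 1) + b + δ / 2) * (2 / δ))
  filter_upwards [h1, h2, eventually_gt_atTop 0] with n hn1 hn2 hn
  have hnR : (0 : ℝ) < n := by exact_mod_cast hn
  simp only [Function.comp, id, norm_eq_abs] at hn1
  rw [abs_of_pos (by positivity : (0 : ℝ) < n + 1)] at hn1
  have h3 : K * log (n + 1) ≤ δ / 2 * (n + 1) := by
    refine (mul_le_mul_of_nonneg_left ((le_abs_self _).trans hn1) hK0.le).trans (le_of_eq ?_)
    field_simp
  have h4 : log (c + 1) + b + δ / 2 ≤ δ / 2 * n := by
    have := mul_le_mul_of_nonneg_left hn2 (half_pos hδ).le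
    refine le_trans (le_of_eq ?_) this
    field_simp
  have h5 : ((n : ℝ) + 1) ^ a = exp (a * log (n + 1)) := by
    rw [exp_nat_mul, exp_log (by positivity)]
  have h6 : (n : ℝ) * c + 1 ≤ exp (log (c + 1) + log (n + 1)) := by
    rw [exp_add, exp_log (by positivity), exp_log (by positivity)]
    nlinarith
  have h7 : b * log n ≤ b * log (n + 1) :=
    mul_le_mul_of_nonneg_left (log_le_log hnR (by linarith)) hb
  calc ((n : ℝ) + 1) ^ a * (n * c + 1) * exp (b * (log n + 1))
      ≤ exp (a * log (n + 1)) * exp (log (c + 1) + log (n + 1)) * exp (b * (log n + 1)) := by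
        rw [h5]; gcongr
    _ = exp (a * log (n + 1) + (log (c + 1) + log (n + 1)) + b * (log n + 1)) := by
        rw [← exp_add, ← exp_add]
    _ ≤ exp (n * δ) := by
        refine exp_le_exp.2 ?_
        rw [hK] at h3
        linarith

theorem inv_mul_log2_le {n : ℕ} (hn : 0 < n) {x t : ℝ} (h : x ≤ exp (n * t)) :
    ((1 / (n : ℝ) : ℝ) : EReal) * log2 x ≤ ((t / log 2 : ℝ) : EReal) := by
  have hnR : (0 : ℝ) < n := by exact_mod_cast hn
  unfold log2
  split_ifs with hx
  · rw [EReal.coe_mul_bot_of_pos (one_div_pos.2 hnR)]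
    exact bot_le
  · rw [← EReal.coe_mul, EReal.coe_le_coe_iff, logb_two_eq]
    have h1 := log_le_log (not_le.1 hx) h
    rw [log_exp] at h1
    rw [← mul_div_assoc]
    refine div_le_div_of_nonneg_right ?_ log_two_pos.le
    rwa [one_div, inv_mul_le_iff₀ hnR]

theorem le_inv_mul_log2 {n : ℕ} (hn : 0 < n) {x t : ℝ} (h : exp (n * t) ≤ x) :
    ((t / log 2 : ℝ) : EReal) ≤ ((1 / (n : ℝ) : ℝ) : EReal) * log2 x := by
  have hnR : (0 : ℝ) < n := by exact_mod_cast hn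
  have hx : 0 < x := (exp_pos _).trans_le h
  rw [log2, if_neg hx.not_ge, ← EReal.coe_mul, EReal.coe_le_coe_iff, logb_two_eq]
  have h1 := log_le_log (exp_pos _) h
  rw [log_exp] at h1
  rw [← mul_div_assoc]
  refine div_le_div_of_nonneg_right ?_ log_two_pos.le
  rwa [one_div, le_inv_mul_iff₀ hnR]

end Asymptotics

/-! ### Achievability and converse for the exponent -/

section Achievability

variable {A : Type*} [Fintype A] [DecidableEq A] {n : ℕ}

theorem prodMass_typeClass_le (hn : 0 < n) {P : A → ℝ} (hP : ∀ a, 0 < P a) (x : Fin n → A) :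
    prodMass P (typeClass x) ≤ exp (-(n * klNat (empirical x) P) + (log n + 1)) := by
  have hnR : (0 : ℝ) < n := by exact_mod_cast hn
  have hc : (0 : ℝ) < (typeClass x).card := by exact_mod_cast card_typeClass_pos x
  have hkl : ∑ a, (typeCount x a : ℝ) * log (P a) =
      -(n * klNat (empirical x) P) - n * entropy (empirical x) := by
    rw [klNat, entropy, Finset.mul_sum, Finset.mul_sum, ← Finset.sum_neg_distrib,
      ← Finset.sum_sub_distrib]
    refine Finset.sum_congr rfl fun a _ => ?_
    have h1 : (typeCount x a : ℝ) = n * empirical x a := by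
      unfold empirical
      field_simp
    rw [h1, negMulLog]
    rcases eq_or_ne (empirical x a) 0 with h | h
    · simp [h]
    · rw [log_div h (hP a).ne']
      ring
  rw [prodMass_eq_of_typeCount_eq hP x subset_rfl, hkl, ← exp_log hc, ← exp_add, exp_le_exp]
  have := log_card_typeClass_le hn x
  linarith

/-- Upper bound of Sanov type. -/
theorem prodMass_le_of_le_klNat (hn : 0 < n) {P : A → ℝ} (hP : ∀ a, 0 < P a) {c : ℝ}
    (U : Finset (Fin n → A)) (hU : ∀ x ∈ U, c ≤ klNat (empirical x) P) :
    prodMass P U ≤ ((n : ℝ) + 1) ^ Fintype.card A * exp (-(n * c) + (log n + 1)) := by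
  have hcard : ((U.image typeCount).card : ℝ) ≤ ((n : ℝ) + 1) ^ Fintype.card A := by
    exact_mod_cast card_image_typeCount_le U
  refine le_trans ?_ (mul_le_mul_of_nonneg_right hcard (exp_pos _).le)
  rw [prodMass, ← Finset.sum_fiberwise_of_maps_to (t := U.image typeCount) (g := typeCount)
    fun x hx => Finset.mem_image_of_mem _ hx, ← nsmul_eq_mul]
  refine Finset.sum_le_card_nsmul _ _ _ fun k hk => ?_
  obtain ⟨x, hx, rfl⟩ := Finset.mem_image.1 hk
  calc prodMass P (U.filter fun y => typeCount y = typeCount x)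
      ≤ prodMass P (typeClass x) := prodMass_mono (fun a => (hP a).le) fun y hy =>
        mem_typeClass.2 (Finset.mem_filter.1 hy).2
    _ ≤ exp (-(n * klNat (empirical x) P) + (log n + 1)) := prodMass_typeClass_le hn hP x
    _ ≤ _ := by
        have := hU x hx
        gcongr

theorem exists_cover_of_typeClass_covers {M : A → ℝ} (hM : ∀ a, 0 < M a) {ρ : A → A → ℝ}
    {D B : ℝ} (hB : 0 ≤ B) (G : Finset (Fin n → A))
    (h : ∀ x ∈ G, ∃ C : Finset (Fin n → A), typeClass x ⊆ blowup ρ D C ∧ prodMass M C ≤ B) :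
    ∃ C : Finset (Fin n → A), G ⊆ blowup ρ D C ∧
      prodMass M C ≤ ((n : ℝ) + 1) ^ Fintype.card A * B := by
  have h' : ∀ k : A → ℕ, ∃ C : Finset (Fin n → A), k ∈ G.image typeCount →
      (∀ x, typeCount x = k → x ∈ blowup ρ D C) ∧ prodMass M C ≤ B := by
    intro k
    by_cases hk : k ∈ G.image typeCount
    · obtain ⟨x, hx, rfl⟩ := Finset.mem_image.1 hk
      obtain ⟨C, hC, hCB⟩ := h x hx
      exact ⟨C, fun _ => ⟨fun y hy => hC (mem_typeClass.2 hy), hCB⟩⟩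
    · exact ⟨∅, fun hk' => absurd hk' hk⟩
  choose F hF using h'
  refine ⟨(G.image typeCount).biUnion F, fun x hx => ?_, ?_⟩
  · have hk := Finset.mem_image_of_mem typeCount hx
    obtain ⟨y, hy, hxy⟩ := mem_blowup.1 ((hF _ hk).1 x rfl)
    exact mem_blowup.2 ⟨y, Finset.mem_biUnion.2 ⟨_, hk, hy⟩, hxy⟩
  · have hcard : ((G.image typeCount).card : ℝ) ≤ ((n : ℝ) + 1) ^ Fintype.card A := by
      exact_mod_cast card_image_typeCount_le G
    refine ((prodMass_biUnion_le (fun a => (hM a).le) _ _).trans ?_).trans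
      (mul_le_mul_of_nonneg_right hcard hB)
    rw [← nsmul_eq_mul]
    exact Finset.sum_le_card_nsmul _ _ _ fun k hk => (hF k hk).2

/-- Achievability: the cheapest covers of the words whose type has rate at most `R` respect the
mass constraint, and leave uncovered only types of relative entropy at least `Estar`. -/
theorem Estar_le_bestExponent {P : A → ℝ} (hP : P ∈ stdSimplex ℝ A) (hPpos : ∀ a, 0 < P a)
    {M : A → ℝ} (hM : ∀ a, 0 < M a) {ρ : A → A → ℝ} (hρ : ∀ x y, 0 ≤ ρ x y)
    (hρ0 : ∀ a, ∃ b, ρ a b = 0) {D : ℝ} (hD0 : 0 ≤ D) (R : ℝ) :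
    Estar ρ P M R D ≤ bestExponent ρ P M R D := by
  classical
  have hlog2 := log_two_pos
  set G : (n : ℕ) → Finset (Fin n → A) := fun n =>
    Finset.univ.filter fun x => rate ρ D (empirical x) M ≤ (R : EReal) with hG
  have hex : ∀ n, ∃ C : Finset (Fin n → A), G n ⊆ blowup ρ D C ∧
      ∀ C', G n ⊆ blowup ρ D C' → prodMass M C ≤ prodMass M C' := by
    intro n
    have hne : (Finset.univ.filter fun C : Finset (Fin n → A) => G n ⊆ blowup ρ D C).Nonempty := by
      choose g hg using hρ0
      refine ⟨Finset.univ, Finset.mem_filter.2 ⟨Finset.mem_univ _, fun x _ => ?_⟩⟩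
      exact mem_blowup.2 ⟨fun i => g (x i), Finset.mem_univ _, by simpa [distortion, hg] using hD0⟩
    obtain ⟨C, hC, hmin⟩ := Finset.exists_min_image _ (prodMass M) hne
    exact ⟨C, (Finset.mem_filter.1 hC).2, fun C' hC' =>
      hmin C' (Finset.mem_filter.2 ⟨Finset.mem_univ _, hC'⟩)⟩
  choose C hGC hmin using hex
  have hlogA : 0 ≤ log (Fintype.card A : ℝ) := log_natCast_nonneg _
  refine le_iSup₂_of_le C ?_ ?_
  · refine EReal.le_of_forall_lt_iff_le.1 fun z hz => ?_
    have hz' : R < z := EReal.coe_lt_coe_iff.1 hz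
    set δ : ℝ := (z - R) * log 2 / 2 with hδ
    have hδ0 : 0 < δ := half_pos (mul_pos (sub_pos.2 hz') hlog2)
    refine limsup_le_of_le (by isBoundedDefault) ?_
    filter_upwards [eventually_exists_cover_of_rate_le hM hρ hρ0 D R hδ0,
      eventually_poly_mul_exp_log_le_exp (Fintype.card A)
        (b := (Fintype.card (A × A) : ℝ) + 2) (by positivity) hlogA hδ0,
      eventually_gt_atTop 0] with n hcov hpoly hn
    obtain ⟨C', hC', hCM⟩ := exists_cover_of_typeClass_covers hM (by positivity) (G n)
      fun x hx => hcov x (Finset.mem_filter.1 hx).2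
    have hle : prodMass M (C n) ≤ exp (n * (z * log 2)) := by
      refine ((hmin n C' hC').trans hCM).trans ?_
      rw [exp_add, show (n : ℝ) * (z * log 2) = n * (R * log 2 + δ) + n * δ by rw [hδ]; ring,
        exp_add (n * (R * log 2 + δ)) (n * δ)]
      have := mul_le_mul_of_nonneg_left hpoly (exp_pos (n * (R * log 2 + δ))).le
      linarith
    have := inv_mul_log2_le hn hle
    rwa [mul_div_cancel_right₀ _ hlog2.ne'] at this
  · refine EReal.ge_of_forall_gt_iff_ge.1 fun z hz => ?_
    obtain ⟨c, hzc, hc⟩ := EReal.lt_iff_exists_real_btwn.1 hz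
    have hzc' : z < c := EReal.coe_lt_coe_iff.1 hzc
    refine le_liminf_of_le (by isBoundedDefault) ?_
    filter_upwards [eventually_poly_mul_exp_log_le_exp (Fintype.card A) zero_le_one le_rfl
      (mul_pos (sub_pos.2 hzc') hlog2), eventually_gt_atTop 0] with n hpoly hn
    have hU : ∀ x ∈ (blowup ρ D (C n))ᶜ, c * log 2 ≤ klNat (empirical x) P := by
      intro x hx
      have hxG : x ∉ G n := fun h => (Finset.mem_compl.1 hx) (hGC n h)
      have hrate : (R : EReal) < rate ρ D (empirical x) M := by
        simpa [hG] using hxG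
      have h1 : Estar ρ P M R D ≤ relEntropy (empirical x) P :=
        iInf₂_le (empirical x) ⟨empirical_mem_stdSimplex hn x, hrate⟩
      have h2 := hc.trans_le h1
      rw [relEntropy_eq_klNat hPpos, EReal.coe_lt_coe_iff, lt_div_iff₀ hlog2] at h2
      exact h2.le
    have hle : 1 - prodMass P (blowup ρ D (C n)) ≤ exp (n * (-z * log 2)) := by
      rw [← prodMass_compl hP]
      refine (prodMass_le_of_le_klNat hn hPpos _ hU).trans ?_
      rw [show (n : ℝ) * (-z * log 2) = -(n * (c * log 2)) + n * ((c - z) * log 2) by ring,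
        exp_add, exp_add (-(n * (c * log 2))) (n * ((c - z) * log 2))]
      have := mul_le_mul_of_nonneg_left hpoly (exp_pos (-(n * (c * log 2)))).le
      simp only [mul_zero, zero_add, mul_one, one_mul] at this
      linarith
    have := inv_mul_log2_le hn hle
    rw [mul_div_cancel_right₀ _ hlog2.ne', EReal.coe_neg] at this
    exact EReal.le_neg_of_le_neg this

end Achievability

/-- Converse: every `Q` whose rate exceeds `R` keeps a fixed fraction of its mass uncovered, and
this costs at least `2 ^ (-n H(Q‖P))` under `P^n`. -/
theorem bestExponent_le_Estar {A : Type*} [Fintype A] {P : A → ℝ} (hP : P ∈ stdSimplex ℝ A)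
    (hPpos : ∀ a, 0 < P a) {M : A → ℝ} (hM : ∀ a, 0 < M a) {ρ : A → A → ℝ}
    (hρ : ∀ x y, 0 ≤ ρ x y) {D : ℝ} (hD0 : 0 ≤ D) (R : ℝ) :
    bestExponent ρ P M R D ≤ Estar ρ P M R D := by
  classical
  have hlog2 := log_two_pos
  refine iSup₂_le fun C hC => le_iInf₂ fun Q hQR => ?_
  obtain ⟨hQ, hQR⟩ := hQR
  refine EReal.le_of_forall_lt_iff_le.1 fun z hz => ?_
  rw [relEntropy_eq_klNat hPpos, EReal.coe_lt_coe_iff, div_lt_iff₀ hlog2] at hz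
  obtain ⟨r, hRr, η, hη, hgap⟩ := exists_gap_of_lt_rate hQR
  -- the summand `η` makes the exceptional mass `ε = η / B` smaller than one
  set B : ℝ := (∑ x, ∑ y, ρ x y) + η + 1 with hBdef
  have hsum0 : 0 ≤ ∑ x, ∑ y, ρ x y :=
    Finset.sum_nonneg fun x _ => Finset.sum_nonneg fun y _ => hρ x y
  have hB : ∀ x y, ρ x y ≤ B := by
    intro x y
    have h1 : ρ x y ≤ ∑ y, ρ x y :=
      Finset.single_le_sum (f := fun y => ρ x y) (fun y _ => hρ x y) (Finset.mem_univ y)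
    have h2 : ∑ y, ρ x y ≤ ∑ x, ∑ y, ρ x y :=
      Finset.single_le_sum (f := fun x => ∑ y, ρ x y)
        (fun x _ => Finset.sum_nonneg fun y _ => hρ x y) (Finset.mem_univ x)
    linarith
  have hB0 : 0 < B := by linarith
  have hε0 : 0 < η / B := div_pos hη hB0
  have hε1 : η / B < 1 := (div_lt_one hB0).2 (by linarith)
  have hlt : ∀ᶠ n : ℕ in atTop,
      ((1 / (n : ℝ) : ℝ) : EReal) * log2 (prodMass M (C n)) < (r : EReal) :=
    eventually_lt_of_limsup_lt (lt_of_le_of_lt hC (EReal.coe_lt_coe_iff.2 hRr))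
      (by isBoundedDefault)
  refine liminf_le_of_frequently_le' (Eventually.frequently ?_)
  filter_upwards [hlt, eventually_exp_le_prodMass hPpos hQ (sub_pos.2 hz) hε0,
    eventually_gt_atTop 0] with n hn1 hn2 hn
  have hnR : (0 : ℝ) < n := by exact_mod_cast hn
  have hcov : prodMass Q (blowup ρ D (C n)) < 1 - η / B := by
    by_contra! hcon
    have hne : (C n).Nonempty := by
      by_contra hemp
      rw [Finset.not_nonempty_iff_eq_empty.1 hemp] at hcon
      have : prodMass Q (blowup ρ D (∅ : Finset (Fin n → A))) = 0 := by simp [prodMass, blowup]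
      linarith
    obtain ⟨μ, hμ, hμM⟩ := exists_coupling_le_log_prodMass hn hM hB0.le hB hD0 hQ hne hcon
    rw [div_mul_cancel₀ _ hB0.ne'] at hμ
    have h1 : exp (n * (r * log 2)) ≤ prodMass M (C n) := by
      rw [← le_log_iff_exp_le (prodMass_pos hM hne)]
      exact (mul_le_mul_of_nonneg_left (hgap μ hμ).le hnR.le).trans hμM
    have h2 := le_inv_mul_log2 hn h1
    rw [mul_div_cancel_right₀ _ hlog2.ne'] at h2
    exact absurd hn1 h2.not_gt
  have hle : exp (n * (-z * log 2)) ≤ 1 - prodMass P (blowup ρ D (C n)) := by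
    rw [← prodMass_compl hP]
    refine le_trans (le_of_eq ?_) (hn2 _ ?_)
    · congr 1
      ring
    · rw [prodMass_compl hQ]
      linarith
  have := le_inv_mul_log2 hn hle
  rw [mul_div_cancel_right₀ _ hlog2.ne', EReal.coe_neg] at this
  exact EReal.neg_le_of_neg_le this

end SphereCovering

theorem mainTheorem1 {A : Type*} [Fintype A]
    (P : A → ℝ) (hP : P ∈ stdSimplex ℝ A) (hPpos : ∀ a, 0 < P a)
    (M : A → ℝ) (hM : ∀ a, 0 < M a)
    (ρ : A → A → ℝ) (hρ : ∀ x y, 0 ≤ ρ x y) (hρ0 : ∀ a, ∃ b, ρ a b = 0)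
    (D : ℝ) (hD0 : 0 ≤ D) (hD : D < SphereCovering.Dmax ρ)
    (R : ℝ) (hR : SphereCovering.rate ρ D P M < (R : EReal)) (hR' : R < SphereCovering.Rmax M) :
    SphereCovering.bestExponent ρ P M R D = SphereCovering.Estar ρ P M R D := by
  classical
  exact le_antisymm (SphereCovering.bestExponent_le_Estar hP hPpos hM hρ hD0 R)
    (SphereCovering.Estar_le_bestExponent hP hPpos hM hρ hρ0 hD0 R)
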